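/- Let $d\in\mathbb N$ and $\ell\in\mathbb R$. A *profile with $\psi(\infty)=\ell$* is a continuous function $\psi:[0,\infty)\to\mathbb R$ that is twice differentiable on $(0,\infty)$, satisfies there $$\psi''+\Big(\frac{d-1}{\rho}+\frac{\rho}{2}\Big)\psi'-\frac{d-1}{2\rho^2}\sin(2\psi)=0,$$ and tends to $\ell$ as $\rho\to\infty$. It is *north pole* if $\psi(0)=0$ and $\psi'(0)=\alpha$ (one-sided derivative) for some $\alpha\in\mathbb R$, and *south pole* if $\psi(0)=\pi$ and $\psi'(0)=\alpha$ for some $\alpha\in\mathbb R$. It *crosses $\frac\pi2$ exactly once* if there is $\rho_0>0$ with $\psi(\rho_0)=\frac\pi2$ such that $\psi-\frac\pi2$ has one strict sign on $[0,\rho_0)$ and the opposite strict sign on $(\rho_0,\infty)$. (i) If $3\le d\le 6$, then for every $\ell\in[0,\frac\pi2]$ there is a unique north pole profile $\psi$ with $\psi(\infty)=\ell$ and $\psi([0,\infty))\subset[0,\frac\pi2]$. (ii) If $3\le d\le 6$, then there is $\delta^*\in(0,\frac\pi2]$, depending only on $d$, such that for every $\ell\in[\frac\pi2-\delta^*,\frac\pi2)$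 there is a south pole profile $\psi$ with $\psi(\infty)=\ell$ that crosses $\frac\pi2$ exactly once. (iii) If $d\ge 7$, then for every $\ell\in[0,\frac\pi2)$ there is exactly one profile $\psi$ with $\psi(\infty)=\ell$, and this profile is north pole. The case $\ell\in[\frac\pi2,\pi]$ is symmetric: $\psi$ is a profile with $\psi(\infty)=\ell$ if and only if $\pi-\psi$ is a profile with $\psi(\infty)=\pi-\ell$, and $\psi$ satisfies the north pole boundary conditions if and only if $\pi-\psi$ satisfies the south pole ones. -/

import Mathlib

open Set Filter Topology

/-- `ψ` is a classical (twice differentiable) solution on `(0, ∞)` of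
`ψ'' + ((d - 1)/ρ + ρ/2) ψ' - (d - 1)/(2 ρ²) sin (2 ψ) = 0`.
The equation makes the second derivative continuous on `(0, ∞)`. -/
def SolvesExpanderODE (d : ℕ) (ψ : ℝ → ℝ) : Prop :=
  ∀ ρ : ℝ, 0 < ρ →
    DifferentiableAt ℝ ψ ρ ∧ DifferentiableAt ℝ (deriv ψ) ρ ∧
      deriv (deriv ψ) ρ + (((d : ℝ) - 1) / ρ + ρ / 2) * deriv ψ ρ
        - ((d : ℝ) - 1) / (2 * ρ ^ 2) * Real.sin (2 * ψ ρ) = 0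

/-- An expander profile with `ψ(∞) = ℓ`: a solution of the ODE on `(0, ∞)` that is continuous up to
the origin and tends to `ℓ` at infinity. Only the values on `[0, ∞)` matter. No boundary value
at the origin is prescribed here. -/
structure IsProfile (d : ℕ) (ℓ : ℝ) (ψ : ℝ → ℝ) : Prop where
  continuousOn : ContinuousOn ψ (Ici 0)
  ode : SolvesExpanderODE d ψ
  tendsto : Tendsto ψ atTop (𝓝 ℓ)

/-- North pole boundary conditions: `ψ(0) = 0`, `ψ'(0) = α` (one-sided) for some real `α`. -/
def NorthPole (ψ : ℝ → ℝ) : Prop :=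
  ψ 0 = 0 ∧ ∃ α : ℝ, HasDerivWithinAt ψ α (Ici 0) 0

/-- South pole boundary conditions: `ψ(0) = π`, `ψ'(0) = α` (one-sided) for some real `α`. -/
def SouthPole (ψ : ℝ → ℝ) : Prop :=
  ψ 0 = Real.pi ∧ ∃ α : ℝ, HasDerivWithinAt ψ α (Ici 0) 0

/-- On `[0, ∞)` the function `f` takes the value `c` at exactly one point, which is positive, and
passes there from one side of `c` to the other. -/
def CrossesExactlyOnce (f : ℝ → ℝ) (c : ℝ) : Prop :=
  ∃ ρ₀ : ℝ, 0 < ρ₀ ∧ f ρ₀ = c ∧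
    (((∀ ρ ∈ Ico 0 ρ₀, f ρ < c) ∧ ∀ ρ ∈ Ioi ρ₀, c < f ρ) ∨
      ((∀ ρ ∈ Ico 0 ρ₀, c < f ρ) ∧ ∀ ρ ∈ Ioi ρ₀, f ρ < c))

/-!
Write `v = ρ ψ'`, so that in the variable `log ρ` the equation is the damped pendulum
`ρ ψ' = v`, `ρ v' = -(d - 2 + ρ²/2) v + (d - 1)/2 sin (2 ψ)`. Everything rests on monotone
quantities of this system, mostly Wronskians with explicit comparison functions.

*The origin.* The energy `v² - (d - 1) sin² ψ` is nonincreasing. It forces `v → 0` at the origin for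
every solution that is continuous there, hence `ψ(0) ∈ (π/2) ℤ`. If `ψ(0)` is an odd multiple of
`π/2`, the energy is minimal at the origin and `ψ` is constant. If `ψ(0) = 0`, then `|v| ≲ |sin ψ|`,
so `ψ` has a fixed sign or vanishes identically, and it converges at infinity at a uniform rate.

*Uniqueness* (`ExpanderFlow.le_of_same_limits`). The dilation generator `v` of a solution is a strict
supersolution of the linearised equation, because the drift `ρ/2` breaks scale invariance. With the
concavity of `sin (2 ψ)` on `[0, π/2]`, the weighted Wronskian of `v₁` and a positive difference
`ψ₁ - ψ₂` is increasing. It vanishes at the origin, and at infinity it cannot stay positive, because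
a difference that tends to `0` decays like `ρ⁻ᵈ exp (-ρ²/4)` (`decay_of_tendsto_zero`).

*Existence.* The solutions `ψ_α` with `ψ(0) = 0`, `ψ'(0) = α` come from a contraction for `u = ψ/ρ`
in an exponentially weighted space (`exists_regularFamily`); they depend on `α` uniformly on
`[0, ∞)`, so `sup ψ_α` is continuous in `α`. While `ψ_α ≤ π/2` the solution is increasing and
`sup ψ_α` is its limit. As `α` grows, `ψ_α` comes close to `π/2` at any given radius unless it
exceeds `π/2` (`ExpanderFlow.exists_near_equator`). In dimensions `3` to `6` the equator is
oscillatory at small scales, so it is crossed (`ExpanderFlow.not_near_equator`); in dimension at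
least `7` it is never reached (`ExpanderFlow.lt_pi_div_two`). In both cases the intermediate value
theorem yields all limits claimed. In the second case the analysis at the origin shows that every
profile with limit in `[0, π/2)` starts from `0` and takes values in `[0, π/2]`, so that the
uniqueness statement applies to it.

*One crossing* (`exists_crossing_profiles`). Let `a` be the last slope with `sup ψ_a = π/2`. For `α`
slightly larger than `a` the first crossing of the equator happens beyond radius `2`, where the
equator is no longer oscillatory, so `ψ_α` stays above it and so does its limit
(`ExpanderFlow.stays_above_equator`). These limits fill an interval `(π/2, m]`, and the reflection
`ψ ↦ π - ψ` gives the south pole profiles.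
-/

/-! ### Calculus on the half-line -/

lemma monotoneOn_of_hasDerivAt_nonneg {s : Set ℝ} (hs : Convex ℝ s) {f f' : ℝ → ℝ}
    (hf : ∀ x ∈ s, HasDerivAt f (f' x) x) (h : ∀ x ∈ s, 0 ≤ f' x) : MonotoneOn f s :=
  monotoneOn_of_deriv_nonneg hs (fun x hx => (hf x hx).continuousAt.continuousWithinAt)
    (fun x hx => (hf x (interior_subset hx)).differentiableAt.differentiableWithinAt)
    (fun x hx => by rw [(hf x (interior_subset hx)).deriv]; exact h x (interior_subset hx))

lemma strictMonoOn_of_hasDerivAt_pos {s : Set ℝ} (hs : Convex ℝ s) {f f' : ℝ → ℝ}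
    (hf : ∀ x ∈ s, HasDerivAt f (f' x) x) (h : ∀ x ∈ s, 0 < f' x) : StrictMonoOn f s :=
  strictMonoOn_of_deriv_pos hs (fun x hx => (hf x hx).continuousAt.continuousWithinAt)
    (fun x hx => by rw [(hf x (interior_subset hx)).deriv]; exact h x (interior_subset hx))

/-- The first zero of a continuous function that starts positive. -/
lemma exists_first_zero {f : ℝ → ℝ} {a b : ℝ} (hab : a ≤ b) (hf : ContinuousOn f (Icc a b))
    (ha : 0 < f a) (hb : f b ≤ 0) :
    ∃ x ∈ Ioc a b, f x = 0 ∧ ∀ t ∈ Ico a x, 0 < f t := by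
  have hcpt : IsCompact (Icc a b ∩ f ⁻¹' Iic 0) :=
    isCompact_Icc.of_isClosed_subset (hf.preimage_isClosed_of_isClosed isClosed_Icc isClosed_Iic)
      inter_subset_left
  obtain ⟨x, ⟨hx, hx0⟩, hmin⟩ := hcpt.exists_isLeast ⟨b, ⟨hab, le_rfl⟩, hb⟩
  have hpos : ∀ t ∈ Ico a x, 0 < f t := fun t ht => by
    by_contra hcon
    exact absurd (hmin ⟨⟨ht.1, ht.2.le.trans hx.2⟩, not_lt.1 hcon⟩) (not_le.2 ht.2)
  have hax : a < x := hx.1.lt_of_ne (by rintro rfl; exact absurd hx0 (not_le.2 ha))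
  refine ⟨x, ⟨hax, hx.2⟩, le_antisymm hx0 ?_, hpos⟩
  have hcl : x ∈ closure (Ico a x) := by
    rw [closure_Ico hax.ne]
    exact ⟨hx.1, le_rfl⟩
  have hc : ContinuousWithinAt f (Ico a x) x :=
    (hf x hx).mono (fun t ht => ⟨ht.1, ht.2.le.trans hx.2⟩)
  have := ContinuousWithinAt.closure_le (f := fun _ => (0 : ℝ)) hcl continuousWithinAt_const hc
    (fun t ht => (hpos t ht).le)
  simpa using this

/-- The last zero of a continuous function that ends positive. -/
lemma exists_last_zero {f : ℝ → ℝ} {a b : ℝ} (hab : a ≤ b) (hf : ContinuousOn f (Icc a b))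
    (ha : f a ≤ 0) (hb : 0 < f b) :
    ∃ x ∈ Ico a b, f x = 0 ∧ ∀ t ∈ Ioc x b, 0 < f t := by
  have hg : ContinuousOn (fun x => f (-x)) (Icc (-b) (-a)) :=
    hf.comp continuous_neg.continuousOn (fun x hx => ⟨by linarith [hx.2], by linarith [hx.1]⟩)
  obtain ⟨x, hx, hx0, hpos⟩ := exists_first_zero (neg_le_neg hab) hg (by simpa) (by simpa)
  refine ⟨-x, ⟨by linarith [hx.2], by linarith [hx.1]⟩, hx0, fun t ht => ?_⟩
  simpa using hpos (-t) ⟨by linarith [ht.2], by linarith [ht.1]⟩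

/-- The weight `ρ ^ k * exp (q ρ² / 4)`, written as one exponential so that real exponents `k` are
handled by the same rules on `(0, ∞)`. -/
noncomputable def wt (k q ρ : ℝ) : ℝ := Real.exp (k * Real.log ρ + q * ρ ^ 2 / 4)

lemma wt_pos (k q ρ : ℝ) : 0 < wt k q ρ := Real.exp_pos _

lemma hasDerivAt_wt (k q : ℝ) {ρ : ℝ} (hρ : 0 < ρ) :
    HasDerivAt (wt k q) (wt k q ρ * (k + q * ρ ^ 2 / 2) / ρ) ρ := by
  have h := ((((Real.hasDerivAt_log hρ.ne').const_mul k).add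
    (((hasDerivAt_pow 2 ρ).const_mul q).div_const 4))).exp
  have hval : wt k q ρ * (k + q * ρ ^ 2 / 2) / ρ =
      wt k q ρ * (k * ρ⁻¹ + q * ((2 : ℕ) * ρ ^ (2 - 1)) / 4) := by
    field_simp
    push_cast
    ring
  rw [hval]
  exact h

lemma wt_le_of_le_one {k q ρ : ℝ} (hk : 0 ≤ k) (hq : 0 ≤ q) (hρ : 0 < ρ) (hρ1 : ρ ≤ 1) :
    wt k q ρ ≤ Real.exp (q / 4) := by
  refine Real.exp_le_exp.2 ?_
  have h1 : k * Real.log ρ ≤ 0 := mul_nonpos_of_nonneg_of_nonpos hk (Real.log_nonpos hρ.le hρ1)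
  have h2 : q * ρ ^ 2 ≤ q * 1 := mul_le_mul_of_nonneg_left (by nlinarith) hq
  linarith

lemma tendsto_wt_mul_zero {k q : ℝ} (hk : 0 ≤ k) (hq : 0 ≤ q) {f : ℝ → ℝ}
    (hf : Tendsto f (𝓝[>] 0) (𝓝 0)) : Tendsto (fun ρ => wt k q ρ * f ρ) (𝓝[>] 0) (𝓝 0) := by
  refine squeeze_zero_norm' (a := fun ρ => Real.exp (q / 4) * |f ρ|) ?_ ?_
  · filter_upwards [Ioc_mem_nhdsGT (zero_lt_one' ℝ)] with ρ hρ
    rw [norm_mul, Real.norm_of_nonneg (wt_pos _ _ _).le, Real.norm_eq_abs]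
    exact mul_le_mul_of_nonneg_right (wt_le_of_le_one hk hq hρ.1 hρ.2) (abs_nonneg _)
  · simpa using hf.abs.const_mul (Real.exp (q / 4))

/-- The integrating-factor criterion: `wt k q` multiplies `f` to a monotone function. -/
lemma monotoneOn_wt_mul {k q : ℝ} {s : Set ℝ} (hs : Convex ℝ s) (hpos : s ⊆ Ioi 0) {f f' : ℝ → ℝ}
    (hf : ∀ ρ ∈ s, HasDerivAt f (f' ρ / ρ) ρ)
    (h : ∀ ρ ∈ s, 0 ≤ (k + q * ρ ^ 2 / 2) * f ρ + f' ρ) :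
    MonotoneOn (fun ρ => wt k q ρ * f ρ) s := by
  refine monotoneOn_of_hasDerivAt_nonneg hs
    (fun ρ hρ => (hasDerivAt_wt k q (hpos hρ)).mul (hf ρ hρ)) (fun ρ hρ => ?_)
  have hρ0 : 0 < ρ := hpos hρ
  have : wt k q ρ * (k + q * ρ ^ 2 / 2) / ρ * f ρ + wt k q ρ * (f' ρ / ρ)
      = wt k q ρ * ((k + q * ρ ^ 2 / 2) * f ρ + f' ρ) / ρ := by ring
  rw [this]
  exact div_nonneg (mul_nonneg (wt_pos _ _ _).le (h ρ hρ)) hρ0.le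

/-- A monotone function on an interval starting at `0` lies above its limit at `0`. -/
lemma MonotoneOn.le_of_tendsto_zero {s : Set ℝ} {f : ℝ → ℝ} {l : ℝ} (hf : MonotoneOn f s)
    (hs : ∀ ρ ∈ s, 0 < ρ ∧ Ioc 0 ρ ⊆ s) (hl : Tendsto f (𝓝[>] 0) (𝓝 l)) {ρ : ℝ} (hρ : ρ ∈ s) :
    l ≤ f ρ := by
  refine le_of_tendsto hl ?_
  filter_upwards [Ioc_mem_nhdsGT (hs ρ hρ).1] with r hr
  exact hf ((hs ρ hρ).2 hr) hρ hr.2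

/-- A function with a nonnegative limit at `0` is nonnegative if `wt k q` makes it monotone. -/
lemma nonneg_of_monotoneOn_wt_mul {k q : ℝ} (hk : 0 ≤ k) (hq : 0 ≤ q) {s : Set ℝ}
    (hs : ∀ ρ ∈ s, 0 < ρ ∧ Ioc 0 ρ ⊆ s) {f : ℝ → ℝ} {l : ℝ} (hl0 : 0 ≤ l)
    (hl : Tendsto f (𝓝[>] 0) (𝓝 l)) (hf : MonotoneOn (fun ρ => wt k q ρ * f ρ) s) {ρ : ℝ}
    (hρ : ρ ∈ s) : 0 ≤ f ρ := by
  by_contra hneg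
  push Not at hneg
  rcases hl0.lt_or_eq with hl0 | rfl
  · obtain ⟨r, hr, hr'⟩ :=
      ((hl.eventually (lt_mem_nhds hl0)).and (Ioc_mem_nhdsGT (hs ρ hρ).1)).exists
    have h1 := hf ((hs ρ hρ).2 hr') hρ hr'.2
    have h2 := mul_pos (wt_pos k q r) hr
    have h3 := mul_neg_of_pos_of_neg (wt_pos k q ρ) hneg
    simp only at h1
    linarith
  · have h1 := hf.le_of_tendsto_zero hs (tendsto_wt_mul_zero hk hq hl) hρ
    have h3 := mul_neg_of_pos_of_neg (wt_pos k q ρ) hneg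
    linarith

/-- A function with `ρ f'(ρ)` bounded below by a positive constant near `0` diverges
logarithmically there. -/
lemma not_tendsto_zero_of_le {f g : ℝ → ℝ} {κ ε l : ℝ} (hκ : 0 < κ) (hε : 0 < ε)
    (hf : ∀ ρ ∈ Ioo 0 ε, HasDerivAt f (g ρ / ρ) ρ) (hg : ∀ ρ ∈ Ioo 0 ε, κ ≤ g ρ)
    (hl : Tendsto f (𝓝[>] 0) (𝓝 l)) : False := by
  have hmono : MonotoneOn (fun ρ => f ρ - κ * Real.log ρ) (Ioo 0 ε) := by
    refine monotoneOn_of_hasDerivAt_nonneg (convex_Ioo 0 ε) (fun ρ hρ => (hf ρ hρ).sub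
      ((Real.hasDerivAt_log hρ.1.ne').const_mul κ)) (fun ρ hρ => ?_)
    have : g ρ / ρ - κ * ρ⁻¹ = (g ρ - κ) / ρ := by ring
    rw [this]
    exact div_nonneg (sub_nonneg.2 (hg ρ hρ)) hρ.1.le
  have hmem : ε / 2 ∈ Ioo 0 ε := ⟨by linarith, by linarith⟩
  have h1 : Tendsto (fun ρ => κ * Real.log ρ + (f (ε / 2) - κ * Real.log (ε / 2)))
      (𝓝[>] 0) atBot :=
    tendsto_atBot_add_const_right _ _
      ((tendsto_const_mul_atBot_of_pos hκ).2 Real.tendsto_log_nhdsGT_zero)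
  have h2 : Tendsto f (𝓝[>] 0) atBot := by
    refine tendsto_atBot_mono' _ ?_ h1
    filter_upwards [Ioo_mem_nhdsGT hmem.1] with r hr
    have := hmono ⟨hr.1, hr.2.trans hmem.2⟩ hmem hr.2.le
    simp only at this
    linarith
  exact not_tendsto_nhds_of_tendsto_atBot h2 l hl

/-! ### The equation as a first-order system and its energy -/

/-- The profile equation on `s` as a first-order system for `ψ` and `v = ρ ψ'`, that is, in the
variable `log ρ`. The dimension enters as a real parameter `c`. -/
def ExpanderFlow (c : ℝ) (ψ v : ℝ → ℝ) (s : Set ℝ) : Prop :=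
  ∀ ρ ∈ s, HasDerivAt ψ (v ρ / ρ) ρ ∧
    HasDerivAt v ((-(c - 2 + ρ ^ 2 / 2) * v ρ + (c - 1) / 2 * Real.sin (2 * ψ ρ)) / ρ) ρ

lemma SolvesExpanderODE.flow {d : ℕ} {ψ : ℝ → ℝ} (h : SolvesExpanderODE d ψ) :
    ExpanderFlow d ψ (fun ρ => ρ * deriv ψ ρ) (Ioi 0) := by
  intro ρ hρ
  have hρ : 0 < ρ := hρ
  obtain ⟨h1, h2, h3⟩ := h ρ hρ
  refine ⟨?_, ?_⟩
  · refine HasDerivAt.congr_deriv (h1.hasDerivAt) ?_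
    field_simp
  · refine HasDerivAt.congr_deriv ((hasDerivAt_id ρ).mul h2.hasDerivAt) ?_
    have h4 : deriv (deriv ψ) ρ = -((((d : ℝ) - 1) / ρ + ρ / 2) * deriv ψ ρ)
        + ((d : ℝ) - 1) / (2 * ρ ^ 2) * Real.sin (2 * ψ ρ) := by linarith
    rw [h4, id]
    field_simp
    ring

lemma ExpanderFlow.solves {d : ℕ} {ψ v : ℝ → ℝ} (h : ExpanderFlow d ψ v (Ioi 0)) :
    SolvesExpanderODE d ψ := by
  intro ρ hρ
  have hev : deriv ψ =ᶠ[𝓝 ρ] fun r => v r / r := by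
    filter_upwards [Ioi_mem_nhds hρ] with r hr
    exact (h r hr).1.deriv
  have h2 : HasDerivAt (deriv ψ) _ ρ :=
    (((h ρ hρ).2.div (hasDerivAt_id ρ) hρ.ne')).congr_of_eventuallyEq hev
  refine ⟨(h ρ hρ).1.differentiableAt, h2.differentiableAt, ?_⟩
  rw [h2.deriv, (h ρ hρ).1.deriv]
  simp only [id]
  field_simp
  ring

lemma ExpanderFlow.mono {c : ℝ} {ψ v : ℝ → ℝ} {s t : Set ℝ} (h : ExpanderFlow c ψ v s)
    (hts : t ⊆ s) : ExpanderFlow c ψ v t := fun ρ hρ => h ρ (hts hρ)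

lemma ExpanderFlow.sub_int_mul_pi {c : ℝ} {ψ v : ℝ → ℝ} {s : Set ℝ} (h : ExpanderFlow c ψ v s)
    (k : ℤ) : ExpanderFlow c (fun ρ => ψ ρ - k * Real.pi) v s := by
  intro ρ hρ
  refine ⟨(h ρ hρ).1.sub_const _, ?_⟩
  have : Real.sin (2 * (ψ ρ - k * Real.pi)) = Real.sin (2 * ψ ρ) := by
    rw [show 2 * (ψ ρ - k * Real.pi) = 2 * ψ ρ - k * (2 * Real.pi) by ring]
    exact Real.sin_sub_int_mul_two_pi _ _
  rw [this]
  exact (h ρ hρ).2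

lemma ExpanderFlow.neg {c : ℝ} {ψ v : ℝ → ℝ} {s : Set ℝ} (h : ExpanderFlow c ψ v s) :
    ExpanderFlow c (fun ρ => -ψ ρ) (fun ρ => -v ρ) s := by
  intro ρ hρ
  refine ⟨?_, ?_⟩
  · refine HasDerivAt.congr_deriv ((h ρ hρ).1.neg) ?_
    ring
  · refine HasDerivAt.congr_deriv ((h ρ hρ).2.neg) ?_
    simp only [mul_neg, Real.sin_neg]
    ring

section Energy

variable {c : ℝ} {ψ v : ℝ → ℝ}

/-- The damping makes the energy `v² - (c - 1) sin² ψ` nonincreasing. -/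
lemma ExpanderFlow.antitoneOn_energy {s : Set ℝ} (hs : Convex ℝ s) (hpos : s ⊆ Ioi 0)
    (hc : 2 ≤ c) (h : ExpanderFlow c ψ v s) :
    AntitoneOn (fun ρ => v ρ ^ 2 - (c - 1) * Real.sin (ψ ρ) ^ 2) s := by
  have hm : MonotoneOn (fun ρ => -(v ρ ^ 2 - (c - 1) * Real.sin (ψ ρ) ^ 2)) s := by
    refine monotoneOn_of_hasDerivAt_nonneg hs
      (f' := fun ρ => 2 * (c - 2 + ρ ^ 2 / 2) * v ρ ^ 2 / ρ) (fun ρ hρ => ?_) (fun ρ hρ => ?_)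
    · have hρ0 : 0 < ρ := hpos hρ
      have h1 := (((h ρ hρ).2.pow 2).sub (((h ρ hρ).1.sin.pow 2).const_mul (c - 1))).neg
      refine HasDerivAt.congr_deriv (h1) ?_
      rw [Real.sin_two_mul]
      field_simp
      push_cast
      ring
    · have hρ0 : 0 < ρ := hpos hρ
      have : 0 ≤ c - 2 + ρ ^ 2 / 2 := by nlinarith
      positivity
  intro x hx y hy hxy
  have := hm hx hy hxy
  simp only at this ⊢
  linarith

/-- A solution with vanishing energy at the origin is controlled by `sin ψ`. -/
lemma ExpanderFlow.sq_le_sin_sq {s : Set ℝ} (hs : Convex ℝ s)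
    (hs0 : ∀ ρ ∈ s, 0 < ρ ∧ Ioc 0 ρ ⊆ s) (hc : 2 ≤ c) (h : ExpanderFlow c ψ v s)
    (hψ : Tendsto ψ (𝓝[>] 0) (𝓝 0)) (hv : Tendsto v (𝓝[>] 0) (𝓝 0)) {ρ : ℝ} (hρ : ρ ∈ s) :
    v ρ ^ 2 ≤ (c - 1) * Real.sin (ψ ρ) ^ 2 := by
  have hanti := h.antitoneOn_energy hs (fun r hr => (hs0 r hr).1) hc
  have hlim : Tendsto (fun ρ => -(v ρ ^ 2 - (c - 1) * Real.sin (ψ ρ) ^ 2)) (𝓝[>] 0) (𝓝 0) := by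
    have h1 : Tendsto (fun ρ => Real.sin (ψ ρ)) (𝓝[>] 0) (𝓝 0) := by
      have := (Real.continuous_sin.tendsto 0).comp hψ
      rwa [Real.sin_zero] at this
    simpa using ((hv.pow 2).sub ((h1.pow 2).const_mul (c - 1))).neg
  have := MonotoneOn.le_of_tendsto_zero (fun x hx y hy hxy => neg_le_neg (hanti hx hy hxy))
    hs0 hlim hρ
  linarith

lemma abs_le_of_sq_le_sin_sq {x y : ℝ} (hc : 2 ≤ c) (h : y ^ 2 ≤ (c - 1) * Real.sin x ^ 2) :
    |y| ≤ (c - 1) * |x| := by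
  refine le_of_sq_le_sq ?_ (mul_nonneg (by linarith) (abs_nonneg _))
  have h1 : Real.sin x ^ 2 ≤ x ^ 2 := by
    rw [← sq_abs (Real.sin x), ← sq_abs x]
    exact pow_le_pow_left₀ (abs_nonneg _) Real.abs_sin_le_abs 2
  rw [sq_abs, mul_pow, sq_abs]
  nlinarith [sq_nonneg x]

/-- Near the origin `ρ ψ'` tends to `0` for every solution that is continuous there: otherwise the
energy keeps `|ρ ψ'|` away from zero and `ψ` diverges logarithmically. -/
lemma ExpanderFlow.tendsto_zero {ε l : ℝ} (hε : 0 < ε) (hc : 2 ≤ c)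
    (h : ExpanderFlow c ψ v (Ioo 0 ε)) (hψ : Tendsto ψ (𝓝[>] 0) (𝓝 l)) :
    Tendsto v (𝓝[>] 0) (𝓝 0) := by
  rw [Metric.tendsto_nhds]
  intro κ hκ
  have hanti := h.antitoneOn_energy (convex_Ioo 0 ε) (fun r hr => hr.1) hc
  have hsin : Tendsto (fun ρ => (c - 1) * Real.sin (ψ ρ) ^ 2) (𝓝[>] 0)
      (𝓝 ((c - 1) * Real.sin l ^ 2)) :=
    (((Real.continuous_sin.tendsto l).comp hψ).pow 2).const_mul _
  have hev := (Metric.tendsto_nhds.1 hsin (κ ^ 2 / 4) (by positivity)).and (Ioo_mem_nhdsGT hε)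
  obtain ⟨δ, hδ, hδs⟩ := mem_nhdsGT_iff_exists_Ioo_subset.1 hev
  have hδ : 0 < δ := hδ
  filter_upwards [Ioo_mem_nhdsGT hδ] with r hr
  rw [dist_zero_right, Real.norm_eq_abs]
  by_contra hcon
  push Not at hcon
  have hsq : ∀ ρ ∈ Ioo 0 r, κ ^ 2 / 4 ≤ v ρ ^ 2 := by
    intro ρ hρ
    have hρδ : ρ ∈ Ioo 0 δ := ⟨hρ.1, hρ.2.trans hr.2⟩
    have h1 := hanti (hδs hρδ).2 (hδs hr).2 hρ.2.le
    have h2 := abs_lt.1 (hδs hρδ).1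
    have h3 := abs_lt.1 (hδs hr).1
    have h4 : κ ^ 2 ≤ v r ^ 2 := by
      rw [← sq_abs (v r)]
      exact pow_le_pow_left₀ hκ.le hcon 2
    simp only at h1
    linarith [h2.1, h2.2, h3.1, h3.2, h1]
  have habs : ∀ ρ ∈ Ioo 0 r, κ / 2 ≤ |v ρ| := fun ρ hρ =>
    le_of_sq_le_sq (by rw [sq_abs]; linarith [hsq ρ hρ]) (abs_nonneg _)
  have hflow : ∀ ρ ∈ Ioo 0 r, HasDerivAt ψ (v ρ / ρ) ρ := fun ρ hρ =>
    (h ρ (hδs ⟨hρ.1, hρ.2.trans hr.2⟩).2).1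
  have hcont : ContinuousOn v (Ioo 0 r) := fun ρ hρ =>
    (h ρ (hδs ⟨hρ.1, hρ.2.trans hr.2⟩).2).2.continuousAt.continuousWithinAt
  have hne : ∀ ρ ∈ Ioo 0 r, v ρ ≠ 0 := fun ρ hρ h0 => by
    have := habs ρ hρ
    rw [h0, abs_zero] at this
    linarith
  have hmem : r / 2 ∈ Ioo 0 r := ⟨by linarith [hr.1], by linarith [hr.1]⟩
  -- `v` has a constant sign near the origin
  have hsign : (∀ ρ ∈ Ioo 0 r, 0 < v ρ) ∨ ∀ ρ ∈ Ioo 0 r, v ρ < 0 := by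
    by_contra hno
    push Not at hno
    obtain ⟨⟨a, ha, ha0⟩, b, hb, hb0⟩ := hno
    obtain ⟨x, hx, hx0⟩ := isPreconnected_Ioo.intermediate_value ha hb hcont ⟨ha0, hb0⟩
    exact hne x hx hx0
  rcases hsign with hs | hs
  · exact not_tendsto_zero_of_le (half_pos hκ) hr.1 hflow
      (fun ρ hρ => by rw [← abs_of_pos (hs ρ hρ)]; exact habs ρ hρ) hψ
  · refine not_tendsto_zero_of_le (half_pos hκ) hr.1 (g := fun ρ => - v ρ)
      (fun ρ hρ => ?_) (fun ρ hρ => by rw [← abs_of_neg (hs ρ hρ)]; exact habs ρ hρ) hψ.neg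
    refine HasDerivAt.congr_deriv ((hflow ρ hρ).neg) ?_
    ring

/-- The value of a continuous solution at the origin is a multiple of `π / 2`. -/
lemma ExpanderFlow.sin_two_mul_eq_zero {ε l : ℝ} (hε : 0 < ε) (hc : 2 ≤ c)
    (h : ExpanderFlow c ψ v (Ioo 0 ε)) (hψ : Tendsto ψ (𝓝[>] 0) (𝓝 l)) :
    Real.sin (2 * l) = 0 := by
  have hv := h.tendsto_zero hε hc hψ
  set g : ℝ → ℝ := fun ρ => -(c - 2 + ρ ^ 2 / 2) * v ρ + (c - 1) / 2 * Real.sin (2 * ψ ρ) with hg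
  have hid : Tendsto (fun ρ : ℝ => ρ) (𝓝[>] 0) (𝓝 0) := tendsto_id.mono_left nhdsWithin_le_nhds
  have hlim : Tendsto g (𝓝[>] 0) (𝓝 ((c - 1) / 2 * Real.sin (2 * l))) := by
    have h1 : Tendsto (fun ρ => Real.sin (2 * ψ ρ)) (𝓝[>] 0) (𝓝 (Real.sin (2 * l))) :=
      (Real.continuous_sin.tendsto _).comp (hψ.const_mul 2)
    have h2 := ((((hid.pow 2).div_const 2).const_add (c - 2)).neg.mul hv).add
      (h1.const_mul ((c - 1) / 2))
    simpa [hg] using h2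
  -- the derivative of `v` would be of size `1 / ρ` near the origin
  have key : ∀ (f q : ℝ → ℝ) (L : ℝ), 0 < L → Tendsto q (𝓝[>] 0) (𝓝 L) →
      (∀ ρ ∈ Ioo 0 ε, HasDerivAt f (q ρ / ρ) ρ) → Tendsto f (𝓝[>] 0) (𝓝 0) → False := by
    intro f q L hL hq hf hf0
    obtain ⟨δ, hδ, hδs⟩ := mem_nhdsGT_iff_exists_Ioo_subset.1
      ((hq.eventually (lt_mem_nhds (half_lt_self hL))).and (Ioo_mem_nhdsGT hε))
    exact not_tendsto_zero_of_le (half_pos hL) hδ (fun ρ hρ => hf ρ (hδs hρ).2)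
      (fun ρ hρ => (hδs hρ).1.le) hf0
  by_contra hne
  have hne' : (c - 1) / 2 * Real.sin (2 * l) ≠ 0 := mul_ne_zero (by linarith) hne
  rcases lt_or_gt_of_ne hne' with hneg | hpos
  · refine key (fun ρ => - v ρ) (fun ρ => - g ρ) _ (neg_pos.2 hneg) hlim.neg
      (fun ρ hρ => ?_) (by simpa using hv.neg)
    refine HasDerivAt.congr_deriv ((h ρ hρ).2.neg) ?_
    simp only [hg]
    ring
  · exact key v g _ hpos hlim (fun ρ hρ => (h ρ hρ).2) hv

/-- If `cos ψ` vanishes at the origin, where the energy is then minimal, it vanishes everywhere. -/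
lemma ExpanderFlow.cos_eq_zero {l : ℝ} (hc : 2 ≤ c) (h : ExpanderFlow c ψ v (Ioi 0))
    (hψ : Tendsto ψ (𝓝[>] 0) (𝓝 l)) (hl : Real.cos l = 0) {ρ : ℝ} (hρ : 0 < ρ) :
    Real.cos (ψ ρ) = 0 := by
  have hv := (h.mono Ioo_subset_Ioi_self : ExpanderFlow c ψ v (Ioo 0 1)).tendsto_zero one_pos hc hψ
  have hanti := h.antitoneOn_energy (convex_Ioi 0) subset_rfl hc
  have hsl : Real.sin l ^ 2 = 1 := by nlinarith [Real.sin_sq_add_cos_sq l]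
  have hlim : Tendsto (fun ρ => -(v ρ ^ 2 - (c - 1) * Real.sin (ψ ρ) ^ 2)) (𝓝[>] 0)
      (𝓝 (c - 1)) := by
    have h1 : Tendsto (fun ρ => Real.sin (ψ ρ)) (𝓝[>] 0) (𝓝 (Real.sin l)) :=
      (Real.continuous_sin.tendsto l).comp hψ
    simpa [hsl] using ((hv.pow 2).sub ((h1.pow 2).const_mul (c - 1))).neg
  have h1 := MonotoneOn.le_of_tendsto_zero (fun x hx y hy hxy => neg_le_neg (hanti hx hy hxy))
    (fun r hr => ⟨hr, Ioc_subset_Ioi_self⟩) hlim (mem_Ioi.2 hρ)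
  have h2 := Real.sin_sq_add_cos_sq (ψ ρ)
  have h3 : (c - 1) * Real.cos (ψ ρ) ^ 2 ≤ 0 := by nlinarith [sq_nonneg (v ρ)]
  have h4 : Real.cos (ψ ρ) ^ 2 ≤ 0 := by nlinarith [sq_nonneg (Real.cos (ψ ρ))]
  exact pow_eq_zero_iff two_ne_zero |>.1 (le_antisymm h4 (sq_nonneg _))

/-- `ψ²` cannot decay faster than a fixed power of `ρ`. -/
lemma ExpanderFlow.monotoneOn_wt_mul_sq {s : Set ℝ} (hs : Convex ℝ s)
    (hs0 : ∀ ρ ∈ s, 0 < ρ ∧ Ioc 0 ρ ⊆ s) (hc : 2 ≤ c) (h : ExpanderFlow c ψ v s)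
    (hψ : Tendsto ψ (𝓝[>] 0) (𝓝 0)) (hv : Tendsto v (𝓝[>] 0) (𝓝 0)) :
    MonotoneOn (fun ρ => wt (2 * (c - 1)) 0 ρ * ψ ρ ^ 2) s := by
  refine monotoneOn_wt_mul hs (fun r hr => (hs0 r hr).1) (f' := fun ρ => 2 * ψ ρ * v ρ)
    (fun ρ hρ => ?_) (fun ρ hρ => ?_)
  · refine HasDerivAt.congr_deriv ((h ρ hρ).1.pow 2) ?_
    push_cast
    ring
  · have h1 := abs_le_of_sq_le_sin_sq hc (h.sq_le_sin_sq hs hs0 hc hψ hv hρ)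
    have h2 : |ψ ρ * v ρ| ≤ (c - 1) * ψ ρ ^ 2 := by
      rw [abs_mul, ← sq_abs (ψ ρ)]
      nlinarith [abs_nonneg (ψ ρ)]
    have := (abs_le.1 h2).1
    nlinarith

/-- A solution starting from `0` that is nonzero somewhere is nonzero from then on and also
before. -/
lemma ExpanderFlow.ne_zero (hc : 2 ≤ c) (h : ExpanderFlow c ψ v (Ioi 0))
    (hψ : Tendsto ψ (𝓝[>] 0) (𝓝 0)) (hv : Tendsto v (𝓝[>] 0) (𝓝 0)) {r : ℝ} (hr : 0 < r)
    (hr0 : ψ r ≠ 0) {ρ : ℝ} (hρ : 0 < ρ) : ψ ρ ≠ 0 := by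
  have hs0 : ∀ ρ ∈ Ioi (0 : ℝ), 0 < ρ ∧ Ioc 0 ρ ⊆ Ioi 0 := fun r hr => ⟨hr, Ioc_subset_Ioi_self⟩
  intro hρ0
  rcases le_total r ρ with hle | hle
  · have h1 := h.monotoneOn_wt_mul_sq (convex_Ioi 0) hs0 hc hψ hv hr hρ hle
    have h2 : 0 < wt (2 * (c - 1)) 0 r * ψ r ^ 2 := mul_pos (wt_pos _ _ _) (by positivity)
    simp only [hρ0] at h1
    linarith
  · have h1 : MonotoneOn (fun ρ => wt (-(2 * (c - 1))) 0 ρ * -(ψ ρ ^ 2)) (Ioi 0) := by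
      refine monotoneOn_wt_mul (convex_Ioi 0) subset_rfl (f' := fun ρ => -(2 * ψ ρ * v ρ))
        (fun ρ hρ => ?_) (fun ρ hρ => ?_)
      · refine HasDerivAt.congr_deriv (((h ρ hρ).1.pow 2).neg) ?_
        push_cast
        ring
      · have h1 := abs_le_of_sq_le_sin_sq hc (h.sq_le_sin_sq (convex_Ioi 0) hs0 hc hψ hv hρ)
        have h2 : |ψ ρ * v ρ| ≤ (c - 1) * ψ ρ ^ 2 := by
          rw [abs_mul, ← sq_abs (ψ ρ)]
          nlinarith [abs_nonneg (ψ ρ)]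
        have := (abs_le.1 h2).2
        nlinarith
    have h2 : 0 < wt (-(2 * (c - 1))) 0 r * ψ r ^ 2 := mul_pos (wt_pos _ _ _) (by positivity)
    have h3 := h1 hρ hr hle
    simp only [hρ0] at h3
    linarith

/-- The flow does not return to `0`. Unlike `ExpanderFlow.ne_zero`, this only needs the equation on
`(0, b)`. -/
lemma ExpanderFlow.ne_zero_of_pos {b : ℝ} (hb : 0 < b) (hc : 2 ≤ c) (h : ExpanderFlow c ψ v (Ioo 0 b))
    (hψ : Tendsto ψ (𝓝[>] 0) (𝓝 0)) (hv : Tendsto v (𝓝[>] 0) (𝓝 0))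
    (hcont : ContinuousAt ψ b) (hpos : ∀ ρ ∈ Ioo 0 b, 0 < ψ ρ) : ψ b ≠ 0 := by
  intro hb0
  have hm := h.monotoneOn_wt_mul_sq (convex_Ioo 0 b)
    (fun r hr => ⟨hr.1, fun t ht => ⟨ht.1, ht.2.trans_lt hr.2⟩⟩) hc hψ hv
  have hmem : b / 2 ∈ Ioo 0 b := ⟨by linarith, by linarith⟩
  have hlim : Tendsto (fun ρ => wt (2 * (c - 1)) 0 ρ * ψ ρ ^ 2) (𝓝[<] b)
      (𝓝 (wt (2 * (c - 1)) 0 b * ψ b ^ 2)) :=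
    ((hasDerivAt_wt _ _ hb).continuousAt.mul (hcont.pow 2)).tendsto.mono_left nhdsWithin_le_nhds
  have h1 := ge_of_tendsto hlim (b := wt (2 * (c - 1)) 0 (b / 2) * ψ (b / 2) ^ 2) (by
    filter_upwards [Ioo_mem_nhdsLT hmem.2] with r hr
    exact hm hmem ⟨hmem.1.trans hr.1, hr.2⟩ hr.1.le)
  have h2 := mul_pos (wt_pos (2 * (c - 1)) 0 (b / 2)) (pow_pos (hpos _ hmem) 2)
  rw [hb0] at h1
  linarith

end Energy

/-! ### Behaviour at infinity -/

section Tail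

variable {c : ℝ} {ψ v : ℝ → ℝ}

/-- Solutions with `ψ ≤ π / 2` are increasing. -/
lemma ExpanderFlow.deriv_pos {b : ℝ} (hc : 2 ≤ c) (h : ExpanderFlow c ψ v (Ioi 0))
    (hψ : Tendsto ψ (𝓝[>] 0) (𝓝 0)) (hv : Tendsto v (𝓝[>] 0) (𝓝 0))
    (hpos : ∀ ρ ∈ Ioc 0 b, 0 < ψ ρ) (hle : ∀ ρ ∈ Ioc 0 b, ψ ρ ≤ Real.pi / 2) {ρ : ℝ}
    (hρ : ρ ∈ Ioc 0 b) : 0 < v ρ := by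
  have hs0 : ∀ r ∈ Ioc 0 ρ, 0 < r ∧ Ioc 0 r ⊆ Ioc 0 ρ :=
    fun r hr => ⟨hr.1, Ioc_subset_Ioc_right hr.2⟩
  have hsub : ∀ r ∈ Ioc 0 ρ, r ∈ Ioc 0 b := fun r hr => ⟨hr.1, hr.2.trans hρ.2⟩
  have hm : MonotoneOn (fun ρ => wt (c - 2) 1 ρ * v ρ) (Ioc 0 ρ) := by
    refine monotoneOn_wt_mul (convex_Ioc 0 ρ) (fun r hr => hr.1) (fun r hr => (h r hr.1).2)
      (fun r hr => ?_)
    have : 0 ≤ Real.sin (2 * ψ r) := Real.sin_nonneg_of_nonneg_of_le_pi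
      (by linarith [hpos r (hsub r hr)]) (by linarith [hle r (hsub r hr)])
    nlinarith
  have hnn : ∀ r ∈ Ioc 0 ρ, 0 ≤ v r := fun r hr =>
    nonneg_of_monotoneOn_wt_mul (by linarith) zero_le_one hs0 le_rfl hv hm hr
  refine (hnn ρ ⟨hρ.1, le_rfl⟩).lt_of_ne fun h0 => ?_
  -- `v ρ = 0` would force `v` to vanish on `(0, ρ)`, and then `sin (2 ψ)` as well
  have hv0 : ∀ r ∈ Ioc 0 ρ, v r = 0 := fun r hr => by
    have h1 := hm hr ⟨hρ.1, le_rfl⟩ hr.2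
    simp only [← h0, mul_zero] at h1
    nlinarith [hnn r hr, wt_pos (c - 2) 1 r]
  obtain ⟨r, hr, hr'⟩ := ((hψ.eventually (gt_mem_nhds (half_pos Real.pi_pos))).and
    (Ioo_mem_nhdsGT hρ.1)).exists
  have hev : v =ᶠ[𝓝 r] fun _ => 0 := by
    filter_upwards [Ioo_mem_nhds hr'.1 hr'.2] with t ht using hv0 t ⟨ht.1, ht.2.le⟩
  have h1 := ((h r hr'.1).2.congr_of_eventuallyEq hev.symm).unique (hasDerivAt_const r (0 : ℝ))
  rw [hv0 r ⟨hr'.1, hr'.2.le⟩, mul_zero, zero_add, div_eq_zero_iff] at h1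
  have h2 : 0 < Real.sin (2 * ψ r) := Real.sin_pos_of_pos_of_lt_pi
    (by linarith [hpos r (hsub r ⟨hr'.1, hr'.2.le⟩)]) (by linarith)
  rcases h1 with h1 | h1
  · nlinarith
  · exact hr'.1.ne' h1

/-- The bound `|ρ ψ'| ≤ (c - 1) / ρ` away from the origin, uniform over all solutions. -/
lemma ExpanderFlow.abs_le_div (hc : 3 ≤ c) (h : ExpanderFlow c ψ v (Ioi 0))
    (hψ : Tendsto ψ (𝓝[>] 0) (𝓝 0)) (hv : Tendsto v (𝓝[>] 0) (𝓝 0)) {ρ : ℝ} (hρ : 1 ≤ ρ) :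
    |v ρ| ≤ (c - 1) / ρ := by
  have hE := h.sq_le_sin_sq (convex_Ioi 0) (fun r hr => ⟨hr, Ioc_subset_Ioi_self⟩) (by linarith)
    hψ hv (mem_Ioi.2 one_pos)
  have h1 : |v 1| ≤ c - 1 := by
    refine abs_le_of_sq_le_sq ?_ (by linarith)
    nlinarith [Real.sin_sq_le_one (ψ 1)]
  have key : ∀ σ : ℝ, (σ = 1 ∨ σ = -1) → 0 ≤ (c - 1) / ρ + σ * v ρ := by
    intro σ hσ
    have hm : MonotoneOn (fun ρ => wt (c - 2) 1 ρ * ((c - 1) / ρ + σ * v ρ)) (Ici 1) := by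
      refine monotoneOn_wt_mul (convex_Ici 1) (fun r hr => mem_Ioi.2 (one_pos.trans_le (mem_Ici.1 hr)))
        (f' := fun r => -(c - 1) / r + σ * (-(c - 2 + r ^ 2 / 2) * v r +
          (c - 1) / 2 * Real.sin (2 * ψ r))) (fun r hr => ?_) (fun r hr => ?_)
      · have hr0 : 0 < r := one_pos.trans_le hr
        refine HasDerivAt.congr_deriv (((hasDerivAt_const r (c - 1)).div (hasDerivAt_id r)
          hr0.ne').add ((h r hr0).2.const_mul σ)) ?_
        simp only [id]
        field_simp
        ring
      · have hr1 : 1 ≤ r := hr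
        have hr0 : 0 < r := one_pos.trans_le hr1
        have e : (c - 2 + 1 * r ^ 2 / 2) * ((c - 1) / r + σ * v r) + (-(c - 1) / r +
            σ * (-(c - 2 + r ^ 2 / 2) * v r + (c - 1) / 2 * Real.sin (2 * ψ r)))
            = (c - 1) * ((c - 3) / r) + (c - 1) / 2 * (r + σ * Real.sin (2 * ψ r)) := by
          field_simp
          ring
        rw [e]
        have h2 : 0 ≤ (c - 3) / r := div_nonneg (by linarith) hr0.le
        have h3 : 0 ≤ r + σ * Real.sin (2 * ψ r) := by
          rcases hσ with rfl | rfl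
          · linarith [Real.neg_one_le_sin (2 * ψ r)]
          · linarith [Real.sin_le_one (2 * ψ r)]
        have h4 : 0 ≤ c - 1 := by linarith
        positivity
    have h2 := hm self_mem_Ici hρ hρ
    simp only [div_one] at h2
    have h3 : 0 ≤ c - 1 + σ * v 1 := by
      rcases hσ with rfl | rfl
      · linarith [(abs_le.1 h1).1]
      · linarith [(abs_le.1 h1).2]
    exact nonneg_of_mul_nonneg_right ((mul_nonneg (wt_pos _ _ _).le h3).trans h2) (wt_pos _ _ _)
  exact abs_le.2 ⟨by linarith [key 1 (Or.inl rfl)], by linarith [key (-1) (Or.inr rfl)]⟩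

/-- Solutions settle at the uniform rate `1 / ρ`. -/
lemma ExpanderFlow.abs_sub_le (hc : 3 ≤ c) (h : ExpanderFlow c ψ v (Ioi 0))
    (hψ : Tendsto ψ (𝓝[>] 0) (𝓝 0)) (hv : Tendsto v (𝓝[>] 0) (𝓝 0)) {a b : ℝ} (ha : 1 ≤ a)
    (hab : a ≤ b) : |ψ b - ψ a| ≤ (c - 1) / a := by
  have key : ∀ σ : ℝ, (σ = 1 ∨ σ = -1) →
      MonotoneOn (fun ρ => σ * ψ ρ - (c - 1) / ρ) (Ici 1) := by
    intro σ hσ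
    refine monotoneOn_of_hasDerivAt_nonneg (convex_Ici 1)
      (f' := fun r => (σ * v r + (c - 1) / r) / r) (fun r hr => ?_) (fun r hr => ?_)
    · have hr0 : 0 < r := one_pos.trans_le hr
      refine HasDerivAt.congr_deriv (((h r hr0).1.const_mul σ).sub
        ((hasDerivAt_const r (c - 1)).div (hasDerivAt_id' r) hr0.ne')) ?_
      field_simp
      ring
    · have hr0 : 0 < r := one_pos.trans_le hr
      have h1 := abs_le.1 (h.abs_le_div hc hψ hv hr)
      refine div_nonneg ?_ hr0.le
      rcases hσ with rfl | rfl
      · linarith [h1.1]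
      · linarith [h1.2]
  have hb : 0 ≤ (c - 1) / b := div_nonneg (by linarith) (by linarith)
  have h1 := key 1 (Or.inl rfl) ha (ha.trans hab) hab
  have h2 := key (-1) (Or.inr rfl) ha (ha.trans hab) hab
  simp only at h1 h2
  exact abs_le.2 ⟨by linarith, by linarith⟩

lemma ExpanderFlow.exists_tendsto (hc : 3 ≤ c) (h : ExpanderFlow c ψ v (Ioi 0))
    (hψ : Tendsto ψ (𝓝[>] 0) (𝓝 0)) (hv : Tendsto v (𝓝[>] 0) (𝓝 0)) :
    ∃ l, Tendsto ψ atTop (𝓝 l) := by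
  refine cauchySeq_tendsto_of_complete (Metric.cauchySeq_iff'.2 fun ε hε => ?_)
  refine ⟨max 1 ((c - 1) / ε + 1), fun n hn => ?_⟩
  rw [Real.dist_eq]
  refine (h.abs_sub_le hc hψ hv (le_max_left _ _) hn).trans_lt ?_
  rw [div_lt_comm₀ (by positivity) hε]
  exact (lt_add_one _).trans_le (le_max_right _ _)

end Tail

/-- A positive solution of `z'' + ((c - 1)/ρ + ρ/2) z' ≥ -C z/ρ²` that tends to `0` is eventually
decreasing and decays like `ρ⁻ᶜ exp (-ρ²/4)`. The comparison function is
`(2 - 1/ρ) ρ⁻ᶜ exp (-ρ²/4)`; its Wronskian with `z` is `ζ g - z h` below. -/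
lemma decay_of_tendsto_zero {c C R : ℝ} (hc : 0 ≤ c) (hC : 0 ≤ C) {z ζ r : ℝ → ℝ}
    (hz : ∀ ρ, R ≤ ρ → HasDerivAt z (ζ ρ / ρ) ρ)
    (hζ : ∀ ρ, R ≤ ρ → HasDerivAt ζ ((-(c - 2 + ρ ^ 2 / 2) * ζ ρ + r ρ) / ρ) ρ)
    (hr : ∀ ρ, R ≤ ρ → -C * z ρ ≤ r ρ) (hpos : ∀ ρ, R ≤ ρ → 0 < z ρ)
    (hlim : Tendsto z atTop (𝓝 0)) :
    ∃ K, 0 ≤ K ∧ ∀ᶠ ρ in atTop, ζ ρ ≤ 0 ∧ wt (c - 2) 1 ρ * z ρ ≤ K / ρ ^ 2 := by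
  set S := max R (8 * c + 4 * C + 8) with hS
  set g : ℝ → ℝ := fun ρ => (ρ⁻¹) ^ 2 * (2 - ρ⁻¹) with hg
  set h : ℝ → ℝ := fun ρ => -1 + ρ⁻¹ / 2 - 2 * c * (ρ⁻¹) ^ 2 + (c + 1) * (ρ⁻¹) ^ 3 with hh
  have hSR : ∀ ρ, S ≤ ρ → R ≤ ρ := fun ρ hρ => (le_max_left _ _).trans hρ
  have hS8 : ∀ ρ, S ≤ ρ → 8 * c + 4 * C + 8 ≤ ρ := fun ρ hρ => (le_max_right _ _).trans hρ
  have hS0 : ∀ ρ, S ≤ ρ → 0 < ρ := fun ρ hρ => by linarith [hS8 ρ hρ]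
  have ht : ∀ ρ, S ≤ ρ → 0 < ρ⁻¹ ∧ (8 * c + 4 * C + 8) * ρ⁻¹ ≤ 1 := fun ρ hρ => by
    have h0 := hS0 ρ hρ
    refine ⟨inv_pos.2 h0, ?_⟩
    rw [← div_eq_mul_inv]
    exact (div_le_one h0).2 (hS8 ρ hρ)
  have ht8 : ∀ ρ, S ≤ ρ → ρ⁻¹ ≤ 1 / 8 := fun ρ hρ => by
    obtain ⟨h1, h2⟩ := ht ρ hρ
    nlinarith [mul_nonneg hc h1.le, mul_nonneg hC h1.le]
  have hgpos : ∀ ρ, S ≤ ρ → 0 < g ρ := fun ρ hρ =>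
    mul_pos (pow_pos (ht ρ hρ).1 2) (by linarith [ht8 ρ hρ])
  have hh0 : ∀ ρ, S ≤ ρ → h ρ ≤ 0 := fun ρ hρ => by
    obtain ⟨h1, h2⟩ := ht ρ hρ
    have h3 := ht8 ρ hρ
    have h4 : (c + 1) * ρ⁻¹ ≤ 1 := by nlinarith [mul_nonneg hC h1.le, mul_nonneg hc h1.le]
    have h5 : (c + 1) * ρ⁻¹ ^ 3 ≤ 1 / 64 := by
      have : ρ⁻¹ ^ 2 ≤ 1 / 64 := by nlinarith
      nlinarith [sq_nonneg ρ⁻¹]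
    have h6 : 0 ≤ c * ρ⁻¹ ^ 2 := by positivity
    simp only [hh]
    linarith
  have hhlb : ∀ ρ, S ≤ ρ → -(1 + 2 * c) ≤ h ρ := fun ρ hρ => by
    obtain ⟨h1, h2⟩ := ht ρ hρ
    have h3 := ht8 ρ hρ
    have h5 : 0 ≤ (c + 1) * ρ⁻¹ ^ 3 := by positivity
    have h6 : c * ρ⁻¹ ^ 2 ≤ c * 1 := mul_le_mul_of_nonneg_left (by nlinarith) hc
    simp only [hh]
    linarith
  have hdinv : ∀ ρ, S ≤ ρ → HasDerivAt (fun x : ℝ => x⁻¹) (-(ρ ^ 2)⁻¹) ρ :=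
    fun ρ hρ => hasDerivAt_inv (hS0 ρ hρ).ne'
  have hdg : ∀ ρ, S ≤ ρ → HasDerivAt g (-4 * ρ⁻¹ ^ 3 + 3 * ρ⁻¹ ^ 4) ρ := fun ρ hρ => by
    have h0 := hS0 ρ hρ
    refine HasDerivAt.congr_deriv (((hdinv ρ hρ).pow 2).mul ((hdinv ρ hρ).const_sub 2)) ?_
    simp only [Pi.pow_apply, Nat.cast_ofNat, Nat.add_one_sub_one, pow_one]
    field_simp
    ring
  have hdh : ∀ ρ, S ≤ ρ → HasDerivAt h
      (-(ρ⁻¹ ^ 2 * (1 / 2 - 4 * c * ρ⁻¹ + 3 * (c + 1) * ρ⁻¹ ^ 2))) ρ := fun ρ hρ => by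
    have h0 := hS0 ρ hρ
    refine HasDerivAt.congr_deriv (((((hdinv ρ hρ).div_const 2).const_add (-1)).sub
      (((hdinv ρ hρ).pow 2).const_mul (2 * c))).add (((hdinv ρ hρ).pow 3).const_mul (c + 1))) ?_
    simp only [Nat.cast_ofNat, Nat.add_one_sub_one, pow_one]
    field_simp
    ring
  have hWmono : MonotoneOn (fun ρ => ζ ρ * g ρ - z ρ * h ρ) (Ici S) := by
    refine monotoneOn_of_hasDerivAt_nonneg (convex_Ici S) (f' := fun ρ => r ρ * g ρ * ρ⁻¹ +
      z ρ * (ρ⁻¹ ^ 2 * (1 / 2 - 4 * c * ρ⁻¹ + 3 * (c + 1) * ρ⁻¹ ^ 2)))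
      (fun ρ hρ => ?_) (fun ρ hρ => ?_)
    · have h0 := hS0 ρ hρ
      refine HasDerivAt.congr_deriv (((hζ ρ (hSR ρ hρ)).mul (hdg ρ hρ)).sub
        ((hz ρ (hSR ρ hρ)).mul (hdh ρ hρ))) ?_
      simp only [hg, hh]
      field_simp
      ring
    · obtain ⟨h1, h2⟩ := ht ρ hρ
      have h3 := hr ρ (hSR ρ hρ)
      have h4 := hpos ρ (hSR ρ hρ)
      have h5 : -C * z ρ * (g ρ * ρ⁻¹) ≤ r ρ * (g ρ * ρ⁻¹) :=
        mul_le_mul_of_nonneg_right h3 (mul_pos (hgpos ρ hρ) h1).le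
      have h6 : 0 ≤ 1 / 2 - 4 * c * ρ⁻¹ - 2 * C * ρ⁻¹ := by linarith
      have h7 : 0 ≤ z ρ * ρ⁻¹ ^ 2 * ((1 / 2 - 4 * c * ρ⁻¹ - 2 * C * ρ⁻¹)
          + (3 * (c + 1) + C) * ρ⁻¹ ^ 2) := by positivity
      simp only [hg] at h5 ⊢
      nlinarith
  have hWle : ∀ ρ, S ≤ ρ → ζ ρ * g ρ - z ρ * h ρ ≤ 0 := by
    intro ρ₁ hρ₁
    by_contra hW
    push Not at hW
    set W₀ := ζ ρ₁ * g ρ₁ - z ρ₁ * h ρ₁ with hW₀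
    -- a positive Wronskian makes `z` eventually increasing
    have hev : ∀ᶠ ρ in atTop, (1 + 2 * c) * z ρ < W₀ := by
      have := hlim.const_mul (1 + 2 * c)
      rw [mul_zero] at this
      exact this.eventually (gt_mem_nhds hW)
    obtain ⟨T, hT⟩ := eventually_atTop.1 (hev.and (eventually_ge_atTop ρ₁))
    have hmono : MonotoneOn z (Ici T) := by
      refine monotoneOn_of_hasDerivAt_nonneg (convex_Ici T)
        (fun ρ hρ => hz ρ (hSR ρ (hρ₁.trans (hT ρ hρ).2))) (fun ρ hρ => ?_)
      obtain ⟨h1, h2⟩ := hT ρ hρ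
      have hρS := hρ₁.trans h2
      have h3 := hWmono hρ₁ hρS h2
      simp only at h3
      have h4 := mul_le_mul_of_nonneg_left (hhlb ρ hρS) (hpos ρ (hSR ρ hρS)).le
      have h5 : 0 ≤ ζ ρ * g ρ := by nlinarith
      exact div_nonneg (nonneg_of_mul_nonneg_left h5 (hgpos ρ hρS)) (hS0 ρ hρS).le
    have h1 : z T ≤ 0 := ge_of_tendsto hlim (by
      filter_upwards [eventually_ge_atTop T] with ρ hρ using hmono self_mem_Ici hρ hρ)
    exact absurd (hpos T (hSR T (hρ₁.trans (hT T le_rfl).2))) (not_lt.2 h1)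
  have hquot : MonotoneOn (fun ρ => wt (c - 2) 1 ρ * -(z ρ / g ρ)) (Ici S) := by
    refine monotoneOn_wt_mul (convex_Ici S) (fun ρ hρ => hS0 ρ hρ) (f' := fun ρ =>
      -((ζ ρ * g ρ - z ρ * (ρ * (-4 * ρ⁻¹ ^ 3 + 3 * ρ⁻¹ ^ 4))) / g ρ ^ 2))
      (fun ρ hρ => ?_) (fun ρ hρ => ?_)
    · have h0 := hS0 ρ hρ
      have hg0 := (hgpos ρ hρ).ne'
      refine HasDerivAt.congr_deriv ((hz ρ (hSR ρ hρ)).div (hdg ρ hρ) hg0).neg ?_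
      field_simp
    · have h0 := hS0 ρ hρ
      have hg0 := hgpos ρ hρ
      have e1 : (c - 2 + 1 * ρ ^ 2 / 2) * g ρ - ρ * (-4 * ρ⁻¹ ^ 3 + 3 * ρ⁻¹ ^ 4) = - h ρ := by
        simp only [hg, hh]
        field_simp
        ring
      have e : (c - 2 + 1 * ρ ^ 2 / 2) * -(z ρ / g ρ) +
          -((ζ ρ * g ρ - z ρ * (ρ * (-4 * ρ⁻¹ ^ 3 + 3 * ρ⁻¹ ^ 4))) / g ρ ^ 2)
          = -(ζ ρ * g ρ + z ρ * ((c - 2 + 1 * ρ ^ 2 / 2) * g ρ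
            - ρ * (-4 * ρ⁻¹ ^ 3 + 3 * ρ⁻¹ ^ 4))) / g ρ ^ 2 := by
        generalize ρ * (-4 * ρ⁻¹ ^ 3 + 3 * ρ⁻¹ ^ 4) = q
        field_simp
        ring
      rw [e, e1]
      have := hWle ρ hρ
      exact div_nonneg (by linarith) (sq_nonneg _)
  have hK0 : 0 < wt (c - 2) 1 S * (z S / g S) :=
    mul_pos (wt_pos _ _ _) (div_pos (hpos S (hSR S le_rfl)) (hgpos S le_rfl))
  refine ⟨2 * (wt (c - 2) 1 S * (z S / g S)), by positivity, ?_⟩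
  filter_upwards [eventually_ge_atTop S] with ρ hρ
  have hg0 := hgpos ρ hρ
  refine ⟨?_, ?_⟩
  · have h1 := hWle ρ hρ
    have h2 : ζ ρ * g ρ ≤ 0 := by nlinarith [hpos ρ (hSR ρ hρ), hh0 ρ hρ]
    exact nonpos_of_mul_nonpos_left h2 hg0
  · have h1 := hquot self_mem_Ici hρ hρ
    simp only at h1
    have h2 : wt (c - 2) 1 ρ * z ρ / g ρ ≤ wt (c - 2) 1 S * (z S / g S) := by
      rw [mul_div_assoc]
      linarith
    rw [div_le_iff₀ hg0] at h2
    refine h2.trans ?_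
    have h3 : g ρ ≤ 2 * ρ⁻¹ ^ 2 := by
      simp only [hg]
      nlinarith [(ht ρ hρ).1, pow_pos (ht ρ hρ).1 2]
    rw [div_eq_mul_inv _ (ρ ^ 2), ← inv_pow]
    nlinarith

/-! ### Uniqueness -/

/-- The tangent line inequality for `sin`, which is concave on `[0, π]`. -/
lemma cos_mul_sub_le_sin_sub_sin {a b : ℝ} (hb : 0 ≤ b) (hba : b ≤ a) (ha : a ≤ Real.pi) :
    Real.cos a * (a - b) ≤ Real.sin a - Real.sin b := by
  have hm : MonotoneOn (fun t => Real.sin t - Real.cos a * t) (Icc b a) := by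
    refine monotoneOn_of_hasDerivAt_nonneg (convex_Icc b a) (f' := fun t => Real.cos t - Real.cos a)
      (fun t _ => ?_) (fun t ht => ?_)
    · exact ((Real.hasDerivAt_sin t).sub ((hasDerivAt_id' t).const_mul (Real.cos a))).congr_deriv
        (by ring)
    · exact sub_nonneg.2 (Real.cos_le_cos_of_nonneg_of_le_pi (hb.trans ht.1) ha ht.2)
  have := hm (left_mem_Icc.2 hba) (right_mem_Icc.2 hba) hba
  simp only at this
  linarith

lemma abs_sin_sub_sin_le (a b : ℝ) : |Real.sin a - Real.sin b| ≤ |a - b| := by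
  rw [Real.sin_sub_sin, abs_mul, abs_mul, abs_two]
  have h1 := Real.abs_sin_le_abs (x := (a - b) / 2)
  have h2 := Real.abs_cos_le_one ((a + b) / 2)
  rw [abs_div, abs_two] at h1
  nlinarith [abs_nonneg (Real.sin ((a - b) / 2))]

lemma strictMonoOn_wt_mul {k q : ℝ} {s : Set ℝ} (hs : Convex ℝ s) (hpos : s ⊆ Ioi 0)
    {f f' : ℝ → ℝ} (hf : ∀ ρ ∈ s, HasDerivAt f (f' ρ / ρ) ρ)
    (h : ∀ ρ ∈ s, 0 < (k + q * ρ ^ 2 / 2) * f ρ + f' ρ) :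
    StrictMonoOn (fun ρ => wt k q ρ * f ρ) s := by
  refine strictMonoOn_of_hasDerivAt_pos hs
    (fun ρ hρ => (hasDerivAt_wt k q (hpos hρ)).mul (hf ρ hρ)) (fun ρ hρ => ?_)
  have hρ0 : 0 < ρ := hpos hρ
  have : wt k q ρ * (k + q * ρ ^ 2 / 2) / ρ * f ρ + wt k q ρ * (f' ρ / ρ)
      = wt k q ρ * ((k + q * ρ ^ 2 / 2) * f ρ + f' ρ) / ρ := by ring
  rw [this]
  exact div_pos (mul_pos (wt_pos _ _ _) (h ρ hρ)) hρ0

section Comparison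

variable {c : ℝ} {ψ₁ v₁ ψ₂ v₂ : ℝ → ℝ}

/-- The right-hand side `ρ v'` of the system. For a solution, `v = ρ ψ'` is the generator of
dilations, and it is a strict supersolution of the linearised equation because the drift `ρ / 2` is
not scale invariant. -/
noncomputable def flowAccel (c : ℝ) (ψ v : ℝ → ℝ) (ρ : ℝ) : ℝ :=
  -(c - 2 + ρ ^ 2 / 2) * v ρ + (c - 1) / 2 * Real.sin (2 * ψ ρ)

/-- The Wronskian, without its weight, of the difference of two solutions and the dilation
generator of the first. -/
noncomputable def dilationWronskian (c : ℝ) (ψ₁ v₁ ψ₂ v₂ : ℝ → ℝ) (ρ : ℝ) : ℝ :=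
  (v₁ ρ - v₂ ρ) * v₁ ρ - (ψ₁ ρ - ψ₂ ρ) * flowAccel c ψ₁ v₁ ρ

lemma hasDerivAt_dilationWronskian (h₁ : ExpanderFlow c ψ₁ v₁ (Ioi 0))
    (h₂ : ExpanderFlow c ψ₂ v₂ (Ioi 0)) {ρ : ℝ} (hρ : 0 < ρ) :
    HasDerivAt (dilationWronskian c ψ₁ v₁ ψ₂ v₂)
      ((-(c - 2 + ρ ^ 2 / 2) * dilationWronskian c ψ₁ v₁ ψ₂ v₂ ρ +
        v₁ ρ * ((c - 1) / 2 * (Real.sin (2 * ψ₁ ρ) - Real.sin (2 * ψ₂ ρ)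
          - Real.cos (2 * ψ₁ ρ) * (2 * ψ₁ ρ - 2 * ψ₂ ρ)) + ρ ^ 2 * (ψ₁ ρ - ψ₂ ρ))) / ρ) ρ := by
  have hψ₁ := (h₁ ρ hρ).1
  have hψ₂ := (h₂ ρ hρ).1
  have hv₁ := (h₁ ρ hρ).2
  have hv₂ := (h₂ ρ hρ).2
  have hA : HasDerivAt (flowAccel c ψ₁ v₁) _ ρ :=
    ((((hasDerivAt_pow 2 ρ).div_const 2).const_add (c - 2)).neg.mul hv₁).add
      ((hψ₁.const_mul 2).sin.const_mul ((c - 1) / 2))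
  refine HasDerivAt.congr_deriv (((hv₁.sub hv₂).mul hv₁).sub ((hψ₁.sub hψ₂).mul hA)) ?_
  simp only [dilationWronskian, flowAccel, Pi.sub_apply, Pi.neg_apply, Nat.cast_ofNat,
    Nat.add_one_sub_one, pow_one]
  field_simp
  ring

lemma le_dilationWronskian_source (hc : 2 ≤ c) {ρ : ℝ} (hv : 0 < v₁ ρ)
    (h₁ : ψ₁ ρ ≤ Real.pi / 2) (h₂ : 0 ≤ ψ₂ ρ) (hz : 0 ≤ ψ₁ ρ - ψ₂ ρ) :
    ρ ^ 2 * (ψ₁ ρ - ψ₂ ρ) * v₁ ρ ≤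
      (c - 2 + 1 * ρ ^ 2 / 2) * dilationWronskian c ψ₁ v₁ ψ₂ v₂ ρ +
      (-(c - 2 + ρ ^ 2 / 2) * dilationWronskian c ψ₁ v₁ ψ₂ v₂ ρ +
        v₁ ρ * ((c - 1) / 2 * (Real.sin (2 * ψ₁ ρ) - Real.sin (2 * ψ₂ ρ)
          - Real.cos (2 * ψ₁ ρ) * (2 * ψ₁ ρ - 2 * ψ₂ ρ)) + ρ ^ 2 * (ψ₁ ρ - ψ₂ ρ))) := by
  have h3 := cos_mul_sub_le_sin_sub_sin (a := 2 * ψ₁ ρ) (b := 2 * ψ₂ ρ) (by linarith)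
    (by linarith) (by linarith)
  have h4 : 0 ≤ v₁ ρ * ((c - 1) / 2 * (Real.sin (2 * ψ₁ ρ) - Real.sin (2 * ψ₂ ρ)
          - Real.cos (2 * ψ₁ ρ) * (2 * ψ₁ ρ - 2 * ψ₂ ρ))) :=
    mul_nonneg hv.le (mul_nonneg (by linarith) (by linarith))
  linarith

/-- The quotient `(ψ₁ - ψ₂) / v₁` moves in the direction given by the Wronskian. -/
lemma hasDerivAt_div_dilation (h₁ : ExpanderFlow c ψ₁ v₁ (Ioi 0))
    (h₂ : ExpanderFlow c ψ₂ v₂ (Ioi 0)) {ρ : ℝ} (hρ : 0 < ρ) (hv : v₁ ρ ≠ 0) :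
    HasDerivAt (fun ρ => (ψ₁ ρ - ψ₂ ρ) / v₁ ρ)
      (dilationWronskian c ψ₁ v₁ ψ₂ v₂ ρ / (ρ * v₁ ρ ^ 2)) ρ := by
  refine HasDerivAt.congr_deriv (((h₁ ρ hρ).1.sub (h₂ ρ hρ).1).div (h₁ ρ hρ).2 hv) ?_
  simp only [dilationWronskian, flowAccel, Pi.sub_apply]
  field_simp

/-- Let `ψ₁ ≤ π / 2` and `ψ₂ ≥ 0` be solutions that agree at `0` and at infinity, with `ψ₁`
increasing. Then `ψ₁ ≤ ψ₂`: the Wronskian of `ψ₁ - ψ₂` with the dilation generator is increasing where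
the difference is positive, vanishes at the origin, and is not positive in the limit at infinity. -/
lemma ExpanderFlow.le_of_same_limits (hc : 3 ≤ c) (h₁ : ExpanderFlow c ψ₁ v₁ (Ioi 0))
    (h₂ : ExpanderFlow c ψ₂ v₂ (Ioi 0)) (hψ₁ : Tendsto ψ₁ (𝓝[>] 0) (𝓝 0))
    (hψ₂ : Tendsto ψ₂ (𝓝[>] 0) (𝓝 0)) (hv₁ : Tendsto v₁ (𝓝[>] 0) (𝓝 0))
    (hv₂ : Tendsto v₂ (𝓝[>] 0) (𝓝 0)) {l : ℝ} (hl₁ : Tendsto ψ₁ atTop (𝓝 l))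
    (hl₂ : Tendsto ψ₂ atTop (𝓝 l)) (hle : ∀ ρ, 0 < ρ → ψ₁ ρ ≤ Real.pi / 2)
    (hnn : ∀ ρ, 0 < ρ → 0 ≤ ψ₂ ρ) (hv : ∀ ρ, 0 < ρ → 0 < v₁ ρ) {ρ₀ : ℝ} (hρ₀ : 0 < ρ₀) :
    ψ₁ ρ₀ ≤ ψ₂ ρ₀ := by
  by_contra hlt
  push Not at hlt
  have hz₀ : 0 < ψ₁ ρ₀ - ψ₂ ρ₀ := sub_pos.2 hlt
  set D := dilationWronskian c ψ₁ v₁ ψ₂ v₂ with hD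
  have hWmono : ∀ s : Set ℝ, Convex ℝ s → s ⊆ Ioi 0 → (∀ ρ ∈ s, 0 ≤ ψ₁ ρ - ψ₂ ρ) →
      MonotoneOn (fun ρ => wt (c - 2) 1 ρ * D ρ) s := fun s hs hs0 hz =>
    monotoneOn_wt_mul hs hs0 (fun ρ hρ => hasDerivAt_dilationWronskian h₁ h₂ (hs0 hρ))
      (fun ρ hρ => le_trans (mul_nonneg (mul_nonneg (sq_nonneg ρ) (hz ρ hρ)) (hv ρ (hs0 hρ)).le)
        (le_dilationWronskian_source (by linarith) (hv ρ (hs0 hρ)) (hle ρ (hs0 hρ))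
          (hnn ρ (hs0 hρ)) (hz ρ hρ)))
  have hcont : ContinuousOn (fun ρ => ψ₁ ρ - ψ₂ ρ) (Ioi 0) := fun ρ hρ =>
    ((h₁ ρ hρ).1.continuousAt.sub (h₂ ρ hρ).1.continuousAt).continuousWithinAt
  rcases lt_or_ge 0 (D ρ₀) with hpos | hneg
  · -- the difference stays positive all the way to infinity
    have hzpos : ∀ ρ, ρ₀ ≤ ρ → 0 < ψ₁ ρ - ψ₂ ρ := by
      intro ρ hρ
      by_contra hcon
      obtain ⟨x, hx, hx0, hxpos⟩ := exists_first_zero hρ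
        (hcont.mono (fun t ht => hρ₀.trans_le ht.1)) hz₀ (not_lt.1 hcon)
      have hsub : Icc ρ₀ x ⊆ Ioi 0 := fun t ht => hρ₀.trans_le ht.1
      have hz : ∀ t ∈ Icc ρ₀ x, 0 ≤ ψ₁ t - ψ₂ t := fun t ht => by
        rcases ht.2.lt_or_eq with h | rfl
        · exact (hxpos t ⟨ht.1, h⟩).le
        · exact hx0.ge
      have hW := hWmono _ (convex_Icc ρ₀ x) hsub hz
      have hq := monotoneOn_of_hasDerivAt_nonneg (convex_Icc ρ₀ x)
        (fun t ht => hasDerivAt_div_dilation h₁ h₂ (hsub ht) (hv t (hsub ht)).ne')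
        (fun t ht => by
          have ht0 : 0 < t := hsub ht
          have h3 := hW (left_mem_Icc.2 hx.1.le) ht ht.1
          have h4 : 0 < wt (c - 2) 1 t * D t := (mul_pos (wt_pos _ _ _) hpos).trans_le h3
          have h5 := pos_of_mul_pos_right h4 (wt_pos (c - 2) 1 t).le
          positivity)
      have h6 := hq (left_mem_Icc.2 hx.1.le) (right_mem_Icc.2 hx.1.le) hx.1.le
      simp only [hx0, zero_div] at h6
      exact absurd (div_pos hz₀ (hv ρ₀ hρ₀)) (not_lt.2 h6)
    have hpos' : ∀ ρ, ρ₀ ≤ ρ → 0 < ρ := fun ρ hρ => hρ₀.trans_le hρ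
    obtain ⟨K, hK, hev⟩ := decay_of_tendsto_zero (c := c) (C := c - 1) (R := ρ₀)
      (z := fun ρ => ψ₁ ρ - ψ₂ ρ) (ζ := fun ρ => v₁ ρ - v₂ ρ)
      (r := fun ρ => (c - 1) / 2 * (Real.sin (2 * ψ₁ ρ) - Real.sin (2 * ψ₂ ρ)))
      (by linarith) (by linarith)
      (fun ρ hρ => ((h₁ ρ (hpos' ρ hρ)).1.sub (h₂ ρ (hpos' ρ hρ)).1).congr_deriv (by ring))
      (fun ρ hρ => ((h₁ ρ (hpos' ρ hρ)).2.sub (h₂ ρ (hpos' ρ hρ)).2).congr_deriv (by ring))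
      (fun ρ hρ => by
        have h3 := (abs_le.1 (abs_sin_sub_sin_le (2 * ψ₁ ρ) (2 * ψ₂ ρ))).1
        rw [abs_of_nonneg (by linarith [hzpos ρ hρ])] at h3
        nlinarith)
      hzpos (by simpa using hl₁.sub hl₂)
    have hvlim : Tendsto v₁ atTop (𝓝 0) := by
      refine squeeze_zero_norm' (a := fun ρ => (c - 1) / ρ) ?_
        (tendsto_const_nhds.div_atTop tendsto_id)
      filter_upwards [eventually_ge_atTop 1] with ρ hρ
      exact h₁.abs_le_div hc hψ₁ hv₁ hρ
    have hub : ∀ᶠ ρ in atTop, wt (c - 2) 1 ρ₀ * D ρ₀ ≤ K * (c - 1) * v₁ ρ := by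
      filter_upwards [hev, eventually_ge_atTop 1, eventually_ge_atTop ρ₀] with ρ h3 h4 h5
      have hρ0 := hpos' ρ h5
      have hvρ := hv ρ hρ0
      have hzρ := hzpos ρ h5
      have hw := wt_pos (c - 2) 1 ρ
      have h6 := hWmono (Ici ρ₀) (convex_Ici ρ₀) (fun t ht => hpos' t ht)
        (fun t ht => (hzpos t ht).le) self_mem_Ici h5 h5
      refine h6.trans ?_
      have hsin : 0 ≤ Real.sin (2 * ψ₁ ρ) := Real.sin_nonneg_of_nonneg_of_le_pi
        (by linarith [hnn ρ hρ0]) (by linarith [hle ρ hρ0])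
      have hDle : D ρ ≤ (ψ₁ ρ - ψ₂ ρ) * ((c - 2 + ρ ^ 2 / 2) * v₁ ρ) := by
        have h7 : (v₁ ρ - v₂ ρ) * v₁ ρ ≤ 0 := mul_nonpos_of_nonpos_of_nonneg h3.1 hvρ.le
        have h8 : 0 ≤ (ψ₁ ρ - ψ₂ ρ) * ((c - 1) / 2 * Real.sin (2 * ψ₁ ρ)) :=
          mul_nonneg hzρ.le (mul_nonneg (by linarith) hsin)
        simp only [hD, dilationWronskian, flowAccel]
        linarith
      have h9 : c - 2 + ρ ^ 2 / 2 ≤ (c - 1) * ρ ^ 2 := by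
        have h10 : 1 ≤ ρ ^ 2 := one_le_pow₀ h4
        nlinarith
      calc wt (c - 2) 1 ρ * D ρ
          ≤ wt (c - 2) 1 ρ * ((ψ₁ ρ - ψ₂ ρ) * ((c - 2 + ρ ^ 2 / 2) * v₁ ρ)) :=
            mul_le_mul_of_nonneg_left hDle hw.le
        _ = (wt (c - 2) 1 ρ * (ψ₁ ρ - ψ₂ ρ)) * ((c - 2 + ρ ^ 2 / 2) * v₁ ρ) := by ring
        _ ≤ K / ρ ^ 2 * (((c - 1) * ρ ^ 2) * v₁ ρ) := by
            refine mul_le_mul h3.2 (mul_le_mul_of_nonneg_right h9 hvρ.le) ?_ (by positivity)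
            exact mul_nonneg (by nlinarith) hvρ.le
        _ = K * (c - 1) * v₁ ρ := by field_simp
    have hlim0 := hvlim.const_mul (K * (c - 1))
    rw [mul_zero] at hlim0
    exact absurd (ge_of_tendsto hlim0 hub) (not_le.2 (mul_pos (wt_pos _ _ _) hpos))
  · -- the difference stays positive all the way to the origin
    have hzpos : ∀ ρ ∈ Ioc 0 ρ₀, 0 < ψ₁ ρ - ψ₂ ρ := by
      intro ρ hρ
      by_contra hcon
      obtain ⟨x, hx, hx0, hxpos⟩ := exists_last_zero hρ.2
        (hcont.mono (fun t ht => hρ.1.trans_le ht.1)) (not_lt.1 hcon) hz₀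
      have hsub : Icc x ρ₀ ⊆ Ioi 0 := fun t ht => (hρ.1.trans_le hx.1).trans_le ht.1
      have hz : ∀ t ∈ Icc x ρ₀, 0 ≤ ψ₁ t - ψ₂ t := fun t ht => by
        rcases ht.1.lt_or_eq with h | rfl
        · exact (hxpos t ⟨h, ht.2⟩).le
        · exact hx0.ge
      have hW := hWmono _ (convex_Icc x ρ₀) hsub hz
      have hq := monotoneOn_of_hasDerivAt_nonneg (convex_Icc x ρ₀)
        (fun t ht => (hasDerivAt_div_dilation h₁ h₂ (hsub ht) (hv t (hsub ht)).ne').neg)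
        (fun t ht => by
          have ht0 : 0 < t := hsub ht
          have h3 := hW ht (right_mem_Icc.2 hx.2.le) ht.2
          have h4 : wt (c - 2) 1 t * D t ≤ 0 :=
            h3.trans (mul_nonpos_of_nonneg_of_nonpos (wt_pos _ _ _).le hneg)
          have h5 := nonpos_of_mul_nonpos_right h4 (wt_pos (c - 2) 1 t)
          rw [← neg_div]
          exact div_nonneg (by simpa using h5) (by positivity))
      have h6 := hq (left_mem_Icc.2 hx.2.le) (right_mem_Icc.2 hx.2.le) hx.2.le
      simp only [Pi.neg_apply, hx0, zero_div, neg_zero] at h6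
      linarith [div_pos hz₀ (hv ρ₀ hρ₀)]
    have hWs : StrictMonoOn (fun ρ => wt (c - 2) 1 ρ * D ρ) (Ioc 0 ρ₀) :=
      strictMonoOn_wt_mul (convex_Ioc 0 ρ₀) (fun t ht => ht.1)
        (fun ρ hρ => hasDerivAt_dilationWronskian h₁ h₂ hρ.1)
        (fun ρ hρ => lt_of_lt_of_le
          (mul_pos (mul_pos (pow_pos hρ.1 2) (hzpos ρ hρ)) (hv ρ hρ.1))
          (le_dilationWronskian_source (by linarith) (hv ρ hρ.1) (hle ρ hρ.1)
            (hnn ρ hρ.1) (hzpos ρ hρ).le))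
    have hDlim : Tendsto D (𝓝[>] 0) (𝓝 0) := by
      have hid : Tendsto (fun ρ : ℝ => ρ) (𝓝[>] 0) (𝓝 0) := tendsto_id.mono_left nhdsWithin_le_nhds
      have h1 : Tendsto (fun ρ => Real.sin (2 * ψ₁ ρ)) (𝓝[>] 0) (𝓝 (Real.sin (2 * 0))) :=
        (Real.continuous_sin.tendsto _).comp (hψ₁.const_mul 2)
      have h2 := ((hv₁.sub hv₂).mul hv₁).sub ((hψ₁.sub hψ₂).mul
        (((((hid.pow 2).div_const 2).const_add (c - 2)).neg.mul hv₁).add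
          (h1.const_mul ((c - 1) / 2))))
      have h3 : Tendsto D (𝓝[>] 0) (𝓝 _) := h2
      simpa using h3
    have hmem : ρ₀ / 2 ∈ Ioc 0 ρ₀ := ⟨by linarith, by linarith⟩
    have h3 := hWs hmem ⟨hρ₀, le_rfl⟩ (by linarith)
    have h4 := hWs.monotoneOn.le_of_tendsto_zero
      (fun r hr => ⟨hr.1, Ioc_subset_Ioc_right hr.2⟩)
      (tendsto_wt_mul_zero (by linarith) zero_le_one hDlim) hmem
    have h5 : wt (c - 2) 1 ρ₀ * D ρ₀ ≤ 0 :=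
      mul_nonpos_of_nonneg_of_nonpos (wt_pos _ _ _).le hneg
    simp only at h3 h4
    linarith

end Comparison

/-! ### Solutions that are regular at the origin -/

/-- Projection of `x` to `[0, A]`. -/
noncomputable def clampTo (A x : ℝ) : ℝ := max 0 (min x A)

lemma clampTo_nonneg (A x : ℝ) : 0 ≤ clampTo A x := le_max_left _ _

lemma clampTo_le {A : ℝ} (hA : 0 ≤ A) (x : ℝ) : clampTo A x ≤ A := max_le hA (min_le_right _ _)

lemma clampTo_of_mem {A x : ℝ} (h0 : 0 ≤ x) (hA : x ≤ A) : clampTo A x = x := by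
  rw [clampTo, min_eq_left hA, max_eq_right h0]

lemma clampTo_of_nonpos {A x : ℝ} (hA : 0 ≤ A) (h0 : x ≤ 0) : clampTo A x = 0 := by
  rw [clampTo, min_eq_left (h0.trans hA), max_eq_left h0]

lemma abs_clampTo_sub_le (A x y : ℝ) : |clampTo A x - clampTo A y| ≤ |x - y| :=
  (abs_max_sub_max_le_max _ _ _ _).trans (by
    rw [sub_self, abs_zero]
    refine max_le (abs_nonneg _) ((abs_min_sub_min_le_max _ _ _ _).trans ?_)
    rw [sub_self, abs_zero]
    exact max_le le_rfl (abs_nonneg _))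

lemma continuous_clampTo (A : ℝ) : Continuous (clampTo A) := by
  unfold clampTo
  fun_prop

/-- The integrating factor `r ^ (d + 1) * exp (r² / 4)` of the equation for `u = ψ / ρ`, where
`d = n + 2`. -/
noncomputable def massWeight (n : ℕ) (r : ℝ) : ℝ := r ^ (n + 3) * Real.exp (r ^ 2 / 4)

/-- The nonlinearity of the equation `(massWeight n * u')' = regularSource n r u` for `u = ψ / ρ`,
where `d = n + 2`. -/
noncomputable def regularSource (n : ℕ) (r x : ℝ) : ℝ :=
  Real.exp (r ^ 2 / 4) * (-(r ^ (n + 3) * x / 2) +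
    ((n : ℝ) + 1) / 2 * r ^ n * (Real.sin (2 * r * x) - 2 * r * x))

/-- A Lipschitz constant, relative to `massWeight`, of the nonlinearity on `[0, A]`. -/
noncomputable def lipConst (n : ℕ) (A : ℝ) : ℝ := 1 / 2 + 2 * ((n : ℝ) + 1) * A ^ 2

lemma lipConst_pos (n : ℕ) (A : ℝ) : 0 < lipConst n A := by
  unfold lipConst
  positivity

lemma massWeight_pos (n : ℕ) {r : ℝ} (hr : 0 < r) : 0 < massWeight n r :=
  mul_pos (pow_pos hr _) (Real.exp_pos _)

lemma massWeight_mono (n : ℕ) {r s : ℝ} (hr : 0 ≤ r) (hrs : r ≤ s) :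
    massWeight n r ≤ massWeight n s :=
  mul_le_mul (pow_le_pow_left₀ hr hrs _)
    (Real.exp_le_exp.2 (by nlinarith)) (Real.exp_pos _).le (pow_nonneg (hr.trans hrs) _)

lemma abs_regularSource_sub_le (n : ℕ) {A r x y : ℝ} (hr : 0 ≤ r) (hx : x ∈ Icc 0 A)
    (hy : y ∈ Icc 0 A) :
    |regularSource n r x - regularSource n r y| ≤ lipConst n A * massWeight n r * |x - y| := by
  have hA : 0 ≤ A := hx.1.trans hx.2
  have hsin : |(Real.sin (2 * r * x) - 2 * r * x) - (Real.sin (2 * r * y) - 2 * r * y)|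
      ≤ 4 * A ^ 2 * r ^ 3 * |x - y| := by
    have h1 := Convex.norm_image_sub_le_of_norm_hasDerivWithin_le
      (f := fun t => Real.sin t - t) (f' := fun t => Real.cos t - 1) (C := 2 * r ^ 2 * A ^ 2)
      (s := Icc 0 (2 * r * A)) (x := 2 * r * y) (y := 2 * r * x)
      (fun t _ => ((Real.hasDerivAt_sin t).sub (hasDerivAt_id' t)).hasDerivWithinAt)
      (fun t ht => by
        rw [Real.norm_eq_abs, abs_of_nonpos (by linarith [Real.cos_le_one t])]
        have h2 := Real.one_sub_sq_div_two_le_cos (x := t)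
        have h3 : t ^ 2 ≤ (2 * r * A) ^ 2 := pow_le_pow_left₀ ht.1 ht.2 2
        linarith)
      (convex_Icc _ _)
      ⟨by have := hy.1; positivity, mul_le_mul_of_nonneg_left hy.2 (by positivity)⟩
      ⟨by have := hx.1; positivity, mul_le_mul_of_nonneg_left hx.2 (by positivity)⟩
    rw [Real.norm_eq_abs, Real.norm_eq_abs, ← mul_sub, abs_mul,
      abs_of_nonneg (by positivity : 0 ≤ 2 * r)] at h1
    linarith
  have e : regularSource n r x - regularSource n r y = Real.exp (r ^ 2 / 4) *
      (-(r ^ (n + 3) / 2 * (x - y)) + ((n : ℝ) + 1) / 2 * r ^ n *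
      ((Real.sin (2 * r * x) - 2 * r * x) - (Real.sin (2 * r * y) - 2 * r * y))) := by
    simp only [regularSource]
    ring
  rw [e, abs_mul, abs_of_pos (Real.exp_pos _)]
  have h2 : |-(r ^ (n + 3) / 2 * (x - y)) + ((n : ℝ) + 1) / 2 * r ^ n *
      ((Real.sin (2 * r * x) - 2 * r * x) - (Real.sin (2 * r * y) - 2 * r * y))| ≤
      r ^ (n + 3) / 2 * |x - y| + ((n : ℝ) + 1) / 2 * r ^ n * (4 * A ^ 2 * r ^ 3 * |x - y|) := by
    refine (abs_add_le _ _).trans (add_le_add ?_ ?_)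
    · rw [abs_neg, abs_mul, abs_of_nonneg (by positivity)]
    · rw [abs_mul, abs_of_nonneg (by positivity : 0 ≤ ((n : ℝ) + 1) / 2 * r ^ n)]
      exact mul_le_mul_of_nonneg_left hsin (by positivity)
  refine (mul_le_mul_of_nonneg_left h2 (Real.exp_pos _).le).trans (le_of_eq ?_)
  simp only [lipConst, massWeight]
  ring

lemma regularSource_zero (n : ℕ) (r : ℝ) : regularSource n r 0 = 0 := by simp [regularSource]

lemma regularSource_nonpos (n : ℕ) {r x : ℝ} (hr : 0 ≤ r) (hx : 0 ≤ x) :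
    regularSource n r x ≤ 0 := by
  have h1 : Real.sin (2 * r * x) ≤ 2 * r * x := Real.sin_le (by positivity)
  have h2 : ((n : ℝ) + 1) / 2 * r ^ n * (Real.sin (2 * r * x) - 2 * r * x) ≤ 0 :=
    mul_nonpos_of_nonneg_of_nonpos (by positivity) (by linarith)
  have h3 : 0 ≤ r ^ (n + 3) * x / 2 := by positivity
  exact mul_nonpos_of_nonneg_of_nonpos (Real.exp_pos _).le (by linarith)

/-- The derivative `u'(s)` that the equation, with nonlinearity cut off outside `[0, A]`, assigns
to `u`; it is extended by `0` to negative `s`. -/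
noncomputable def slopeOf (n : ℕ) (A : ℝ) (u : ℝ → ℝ) (s : ℝ) : ℝ :=
  if s ≤ 0 then 0 else (∫ r in (0 : ℝ)..s, regularSource n r (clampTo A (u r))) / massWeight n s

section Slope

variable {n : ℕ} {A : ℝ} {u w : ℝ → ℝ}

lemma continuous_regularSource_clampTo (hu : Continuous u) :
    Continuous fun r => regularSource n r (clampTo A (u r)) := by
  have := (continuous_clampTo A).comp hu
  simp only [Function.comp_def] at this
  unfold regularSource
  fun_prop

lemma slopeOf_of_nonpos {s : ℝ} (hs : s ≤ 0) : slopeOf n A u s = 0 := if_pos hs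

lemma slopeOf_of_pos {s : ℝ} (hs : 0 < s) : slopeOf n A u s =
    (∫ r in (0 : ℝ)..s, regularSource n r (clampTo A (u r))) / massWeight n s :=
  if_neg (not_le.2 hs)

lemma abs_slopeOf_le (hA : 0 ≤ A) (s : ℝ) :
    |slopeOf n A u s| ≤ lipConst n A * A * |s| := by
  have hL := lipConst_pos n A
  rcases le_or_gt s 0 with hs | hs
  · rw [slopeOf_of_nonpos hs, abs_zero]
    positivity
  · rw [slopeOf_of_pos hs, abs_div, abs_of_pos (massWeight_pos n hs), abs_of_pos hs,
      div_le_iff₀ (massWeight_pos n hs)]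
    have := intervalIntegral.norm_integral_le_of_norm_le_const (a := (0 : ℝ)) (b := s)
      (f := fun r => regularSource n r (clampTo A (u r)))
      (C := lipConst n A * massWeight n s * A) (fun r hr => by
        rw [uIoc_of_le hs.le] at hr
        have h1 := abs_regularSource_sub_le n hr.1.le
          ⟨clampTo_nonneg A (u r), clampTo_le hA (u r)⟩ ⟨le_rfl, hA⟩
        rw [regularSource_zero, sub_zero, sub_zero, abs_of_nonneg (clampTo_nonneg _ _)] at h1
        refine h1.trans ?_
        have h2 := massWeight_mono n hr.1.le hr.2
        have h3 := clampTo_le hA (u r)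
        have h4 := clampTo_nonneg A (u r)
        have h5 := massWeight_pos n hs
        gcongr)
    rw [Real.norm_eq_abs, sub_zero, abs_of_pos hs] at this
    linarith

lemma slopeOf_nonpos (s : ℝ) : slopeOf n A u s ≤ 0 := by
  rcases le_or_gt s 0 with hs | hs
  · exact (slopeOf_of_nonpos hs).le
  · rw [slopeOf_of_pos hs]
    refine div_nonpos_of_nonpos_of_nonneg ?_ (massWeight_pos n hs).le
    have := intervalIntegral.integral_nonneg hs.le
      (f := fun r => -regularSource n r (clampTo A (u r))) (μ := MeasureTheory.volume)
      (fun r hr => neg_nonneg.2 (regularSource_nonpos n hr.1 (clampTo_nonneg _ _)))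
    rw [intervalIntegral.integral_neg] at this
    linarith

lemma hasDerivAt_slopeOf (hu : Continuous u) {s : ℝ} (hs : 0 < s) :
    HasDerivAt (slopeOf n A u) (regularSource n s (clampTo A (u s)) / massWeight n s
      - slopeOf n A u s * (((n : ℝ) + 3) / s + s / 2)) s := by
  have hc := continuous_regularSource_clampTo (n := n) (A := A) hu
  have h1 : HasDerivAt (fun s => ∫ r in (0 : ℝ)..s, regularSource n r (clampTo A (u r)))
      (regularSource n s (clampTo A (u s))) s :=
    intervalIntegral.integral_hasDerivAt_right (hc.intervalIntegrable _ _)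
      hc.stronglyMeasurable.stronglyMeasurableAtFilter hc.continuousAt
  have h2 : HasDerivAt (massWeight n) (massWeight n s * (((n : ℝ) + 3) / s + s / 2)) s := by
    refine HasDerivAt.congr_deriv ((hasDerivAt_pow (n + 3) s).mul
      (((hasDerivAt_pow 2 s).div_const 4).exp)) ?_
    simp only [massWeight, Nat.cast_add, Nat.cast_ofNat, Nat.add_one_sub_one, pow_one]
    field_simp
    ring
  have h3 := (h1.div h2 (massWeight_pos n hs).ne').congr_of_eventuallyEq
    (f₁ := slopeOf n A u) (by
      filter_upwards [Ioi_mem_nhds hs] with t ht using slopeOf_of_pos ht)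
  refine h3.congr_deriv ?_
  rw [slopeOf_of_pos hs]
  have := (massWeight_pos n hs).ne'
  field_simp

lemma continuous_slopeOf (hA : 0 ≤ A) (hu : Continuous u) : Continuous (slopeOf n A u) := by
  rw [continuous_iff_continuousAt]
  intro s
  rcases lt_trichotomy s 0 with hs | rfl | hs
  · refine (continuousAt_const (y := (0 : ℝ))).congr ?_
    filter_upwards [Iio_mem_nhds hs] with t ht using (slopeOf_of_nonpos (le_of_lt ht)).symm
  · rw [ContinuousAt, slopeOf_of_nonpos le_rfl]
    refine squeeze_zero_norm (fun t => abs_slopeOf_le hA t) ?_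
    have : Continuous fun t : ℝ => lipConst n A * A * |t| := by fun_prop
    simpa using this.tendsto 0
  · exact (hasDerivAt_slopeOf hu hs).continuousAt

lemma integral_exp_mul_le {k : ℝ} (hk : 0 < k) (s : ℝ) :
    ∫ r in (0 : ℝ)..s, Real.exp (k * r) ≤ Real.exp (k * s) / k := by
  have h : ∀ r ∈ uIcc 0 s, HasDerivAt (fun r => Real.exp (k * r) / k) (Real.exp (k * r)) r :=
    fun r _ => ((((hasDerivAt_id' r).const_mul k).exp).div_const k).congr_deriv (by field_simp)
  rw [intervalIntegral.integral_eq_sub_of_hasDerivAt h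
    ((by fun_prop : Continuous fun r => Real.exp (k * r)).intervalIntegrable _ _)]
  have : 0 < Real.exp (k * 0) / k := div_pos (Real.exp_pos _) hk
  linarith

lemma abs_slopeOf_sub_le (hA : 0 ≤ A) (hu : Continuous u) (hw : Continuous w) {k δ : ℝ}
    (hk : 0 < k) (hδ : 0 ≤ δ) (h : ∀ r, 0 ≤ r → |u r - w r| ≤ δ * Real.exp (k * r)) {s : ℝ}
    (hs : 0 ≤ s) : |slopeOf n A u s - slopeOf n A w s| ≤
      lipConst n A * δ / k * Real.exp (k * s) := by
  have hL := lipConst_pos n A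
  rcases hs.eq_or_lt with rfl | hs
  · rw [slopeOf_of_nonpos le_rfl, slopeOf_of_nonpos le_rfl, sub_zero, abs_zero]
    positivity
  have hm := massWeight_pos n hs
  have hcu := continuous_regularSource_clampTo (n := n) (A := A) hu
  have hcw := continuous_regularSource_clampTo (n := n) (A := A) hw
  rw [slopeOf_of_pos hs, slopeOf_of_pos hs, ← sub_div, abs_div, abs_of_pos hm, div_le_iff₀ hm,
    ← intervalIntegral.integral_sub (hcu.intervalIntegrable _ _) (hcw.intervalIntegrable _ _)]
  have h1 := intervalIntegral.norm_integral_le_of_norm_le (μ := MeasureTheory.volume) hs.le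
    (f := fun r => regularSource n r (clampTo A (u r)) - regularSource n r (clampTo A (w r)))
    (g := fun r => lipConst n A * massWeight n s * δ * Real.exp (k * r))
    (Eventually.of_forall fun r hr => by
      refine (abs_regularSource_sub_le n hr.1.le ⟨clampTo_nonneg A (u r), clampTo_le hA (u r)⟩
        ⟨clampTo_nonneg A (w r), clampTo_le hA (w r)⟩).trans ?_
      have h2 := massWeight_mono n hr.1.le hr.2
      have h3 := (abs_clampTo_sub_le A (u r) (w r)).trans (h r hr.1.le)
      rw [mul_assoc _ δ]
      gcongr)
    ((by fun_prop : Continuous fun r => lipConst n A * massWeight n s * δ *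
      Real.exp (k * r)).intervalIntegrable _ _)
  rw [intervalIntegral.integral_const_mul, Real.norm_eq_abs] at h1
  refine h1.trans ((mul_le_mul_of_nonneg_left (integral_exp_mul_le hk s) (by positivity)).trans
    (le_of_eq ?_))
  ring

lemma integral_slopeOf_of_nonpos {ρ : ℝ} (hρ : ρ ≤ 0) :
    ∫ s in (0 : ℝ)..ρ, slopeOf n A u s = 0 := by
  rw [intervalIntegral.integral_congr (g := fun _ => (0 : ℝ)) (fun s hs => by
    rw [uIcc_of_ge hρ] at hs
    exact slopeOf_of_nonpos hs.2)]
  simp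

lemma abs_integral_slopeOf_le (hA : 0 ≤ A) (ρ : ℝ) :
    |∫ s in (0 : ℝ)..ρ, slopeOf n A u s| ≤ lipConst n A * A * ρ ^ 2 := by
  have hL := lipConst_pos n A
  have := intervalIntegral.norm_integral_le_of_norm_le_const (a := (0 : ℝ)) (b := ρ)
    (f := slopeOf n A u) (C := lipConst n A * A * |ρ|) (fun s hs => by
      refine (abs_slopeOf_le hA s).trans ?_
      have : |s| ≤ |ρ| := by
        rcases le_total 0 ρ with h | h
        · rw [uIoc_of_le h] at hs
          exact abs_le_abs_of_nonneg hs.1.le hs.2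
        · rw [uIoc_of_ge h] at hs
          exact abs_le_abs_of_nonpos hs.2 hs.1.le
      gcongr)
  rw [sub_zero, Real.norm_eq_abs, mul_assoc _ |ρ|, abs_mul_abs_self] at this
  linarith

lemma abs_integral_slopeOf_sub_le (hA : 0 ≤ A) (hu : Continuous u) (hw : Continuous w) {k δ : ℝ}
    (hk : 0 < k) (hδ : 0 ≤ δ) (h : ∀ r, 0 ≤ r → |u r - w r| ≤ δ * Real.exp (k * r)) (ρ : ℝ) :
    |(∫ s in (0 : ℝ)..ρ, slopeOf n A u s) - ∫ s in (0 : ℝ)..ρ, slopeOf n A w s| ≤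
      lipConst n A / k ^ 2 * δ * Real.exp (k * |ρ|) := by
  have hL := lipConst_pos n A
  rcases le_total ρ 0 with hρ | hρ
  · rw [integral_slopeOf_of_nonpos hρ, integral_slopeOf_of_nonpos hρ, sub_zero, abs_zero]
    positivity
  have hcu := continuous_slopeOf (n := n) hA hu
  have hcw := continuous_slopeOf (n := n) hA hw
  rw [← intervalIntegral.integral_sub (hcu.intervalIntegrable _ _) (hcw.intervalIntegrable _ _)]
  have h1 := intervalIntegral.norm_integral_le_of_norm_le (μ := MeasureTheory.volume) hρ
    (f := fun s => slopeOf n A u s - slopeOf n A w s)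
    (g := fun r => lipConst n A * δ / k * Real.exp (k * r))
    (Eventually.of_forall fun r hr => abs_slopeOf_sub_le hA hu hw hk hδ h hr.1.le)
    ((by fun_prop : Continuous fun r => lipConst n A * δ / k *
      Real.exp (k * r)).intervalIntegrable _ _)
  rw [intervalIntegral.integral_const_mul, Real.norm_eq_abs] at h1
  rw [abs_of_nonneg hρ]
  refine h1.trans ((mul_le_mul_of_nonneg_left (integral_exp_mul_le hk ρ) (by positivity)).trans
    (le_of_eq ?_))
  field_simp

end Slope

section FixedPoint

open BoundedContinuousFunction

/-- The exponential rate of the weighted norm in which the integral equation is a contraction. -/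
noncomputable def expRate (n : ℕ) (A : ℝ) : ℝ := 1 + lipConst n A

lemma expRate_pos (n : ℕ) (A : ℝ) : 0 < expRate n A := by
  have := lipConst_pos n A
  unfold expRate
  linarith

/-- The integral operator for `u`, conjugated by the exponential weight so that it acts on bounded
continuous functions. -/
noncomputable def weightedPicard (n : ℕ) {A : ℝ} (hA : 0 ≤ A) (α : ℝ) (b : ℝ →ᵇ ℝ) : ℝ →ᵇ ℝ :=
  BoundedContinuousFunction.ofNormedAddCommGroup
    (fun ρ => Real.exp (-(expRate n A * |ρ|)) *
      (α + ∫ s in (0 : ℝ)..ρ, slopeOf n A (fun r => Real.exp (expRate n A * |r|) * b r) s))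
    (by
      have hc : Continuous (slopeOf n A fun r => Real.exp (expRate n A * |r|) * b r) :=
        continuous_slopeOf hA (by fun_prop)
      have := intervalIntegral.continuous_primitive
        (fun a b => hc.intervalIntegrable (μ := MeasureTheory.volume) a b) 0
      fun_prop)
    (|α| + 2 * (lipConst n A * A))
    (fun ρ => by
      have hL := lipConst_pos n A
      have h1 := abs_integral_slopeOf_le (n := n)
        (u := fun r => Real.exp (expRate n A * |r|) * b r) hA ρ
      have h2 : ρ ^ 2 ≤ 2 * Real.exp (expRate n A * |ρ|) := by
        have h3 := Real.quadratic_le_exp_of_nonneg (abs_nonneg ρ)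
        have h4 : Real.exp |ρ| ≤ Real.exp (expRate n A * |ρ|) := by
          refine Real.exp_le_exp.2 (le_mul_of_one_le_left (abs_nonneg _) ?_)
          unfold expRate
          linarith
        rw [sq_abs] at h3
        linarith [abs_nonneg ρ]
      have h5 : 1 ≤ Real.exp (expRate n A * |ρ|) :=
        Real.one_le_exp (mul_nonneg (expRate_pos n A).le (abs_nonneg _))
      rw [norm_mul, Real.norm_of_nonneg (Real.exp_pos _).le, Real.exp_neg, Real.norm_eq_abs,
        inv_mul_le_iff₀ (Real.exp_pos _)]
      refine (abs_add_le _ _).trans ?_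
      have h6 : lipConst n A * A * ρ ^ 2 ≤
          lipConst n A * A * (2 * Real.exp (expRate n A * |ρ|)) :=
        mul_le_mul_of_nonneg_left h2 (by positivity)
      nlinarith [abs_nonneg α])

lemma weightedPicard_apply (n : ℕ) {A : ℝ} (hA : 0 ≤ A) (α : ℝ) (b : ℝ →ᵇ ℝ) (ρ : ℝ) :
    weightedPicard n hA α b ρ = Real.exp (-(expRate n A * |ρ|)) *
      (α + ∫ s in (0 : ℝ)..ρ, slopeOf n A (fun r => Real.exp (expRate n A * |r|) * b r) s) := rfl

lemma contractingWith_weightedPicard (n : ℕ) {A : ℝ} (hA : 0 ≤ A) (α : ℝ) :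
    ContractingWith (1 / 2) (weightedPicard n hA α) := by
  refine ⟨by norm_num, LipschitzWith.of_dist_le_mul fun b b' => ?_⟩
  have hL := lipConst_pos n A
  have hk := expRate_pos n A
  refine (dist_le (by positivity)).2 fun ρ => ?_
  have h1 := abs_integral_slopeOf_sub_le (n := n) hA
    (u := fun r => Real.exp (expRate n A * |r|) * b r)
    (w := fun r => Real.exp (expRate n A * |r|) * b' r) (by fun_prop) (by fun_prop) hk
    (dist_nonneg (x := b) (y := b')) (fun r hr => by
      rw [← mul_sub, abs_mul, abs_of_pos (Real.exp_pos _), abs_of_nonneg hr, mul_comm,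
        ← Real.dist_eq]
      exact mul_le_mul_of_nonneg_right (dist_coe_le_dist r) (Real.exp_pos _).le) ρ
  rw [weightedPicard_apply, weightedPicard_apply, Real.dist_eq, ← mul_sub, abs_mul,
    abs_of_pos (Real.exp_pos _), add_sub_add_left_eq_sub, Real.exp_neg,
    inv_mul_le_iff₀ (Real.exp_pos _)]
  refine h1.trans ?_
  have h2 : lipConst n A / expRate n A ^ 2 ≤ 1 / 2 := by
    rw [div_le_div_iff₀ (by positivity) two_pos]
    unfold expRate
    nlinarith
  have h3 : ((1 / 2 : NNReal) : ℝ) = 1 / 2 := by norm_num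
  rw [h3]
  calc lipConst n A / expRate n A ^ 2 * dist b b' * Real.exp (expRate n A * |ρ|)
      ≤ 1 / 2 * dist b b' * Real.exp (expRate n A * |ρ|) := by gcongr
    _ = _ := by ring

/-- The integral equation has a solution for every initial slope, with Lipschitz dependence. -/
lemma exists_fixed_family (n : ℕ) {A : ℝ} (hA : 0 ≤ A) : ∃ u : ℝ → ℝ → ℝ,
    (∀ α, Continuous (u α) ∧ ∀ ρ, u α ρ = α + ∫ s in (0 : ℝ)..ρ, slopeOf n A (u α) s) ∧
    ∀ α β ρ, |u α ρ - u β ρ| ≤ 2 * Real.exp (expRate n A * |ρ|) * |α - β| := by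
  set b : ℝ → (ℝ →ᵇ ℝ) := fun α =>
    ContractingWith.fixedPoint _ (contractingWith_weightedPicard n hA α) with hb
  have hfix : ∀ α, weightedPicard n hA α (b α) = b α := fun α =>
    (contractingWith_weightedPicard n hA α).fixedPoint_isFixedPt
  refine ⟨fun α r => Real.exp (expRate n A * |r|) * b α r, fun α => ⟨by fun_prop, fun ρ => ?_⟩,
    fun α β ρ => ?_⟩
  · have h1 := DFunLike.congr_fun (hfix α) ρ
    rw [weightedPicard_apply] at h1
    change Real.exp (expRate n A * |ρ|) * b α ρ = α +
      ∫ s in (0 : ℝ)..ρ, slopeOf n A (fun r => Real.exp (expRate n A * |r|) * b α r) s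
    rw [← h1, ← mul_assoc, ← Real.exp_add, add_neg_cancel, Real.exp_zero, one_mul]
  · have h1 : dist (b α) (b β) ≤ |α - β| / (1 - ((1 / 2 : NNReal) : ℝ)) := by
      refine (contractingWith_weightedPicard n hA α).fixedPoint_lipschitz_in_map
        (contractingWith_weightedPicard n hA β) (fun z => ?_)
      refine (dist_le (abs_nonneg _)).2 fun r => ?_
      rw [weightedPicard_apply, weightedPicard_apply, Real.dist_eq, ← mul_sub, abs_mul,
        abs_of_pos (Real.exp_pos _), add_sub_add_right_eq_sub]
      refine mul_le_of_le_one_left (abs_nonneg _) (Real.exp_le_one_iff.2 ?_)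
      exact neg_nonpos.2 (mul_nonneg (expRate_pos n A).le (abs_nonneg _))
    have h2 : |b α ρ - b β ρ| ≤ 2 * |α - β| := by
      refine (dist_coe_le_dist ρ).trans (h1.trans (le_of_eq ?_))
      push_cast
      ring
    rw [← mul_sub, abs_mul, abs_of_pos (Real.exp_pos _)]
    nlinarith [Real.exp_pos (expRate n A * |ρ|)]

end FixedPoint

/-- `Ψ α`, with `V α = ρ (Ψ α)'`, are the solutions with `ψ(0) = 0` and `ψ'(0) = α ∈ [0, A]`,
together with their basic bounds: positivity, Lipschitz dependence on `α`, and a lower bound near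
the origin for the largest slope. -/
structure RegularFamily (d : ℕ) (A : ℝ) (Ψ V : ℝ → ℝ → ℝ) : Prop where
  flow : ∀ α ∈ Icc 0 A, ExpanderFlow d (Ψ α) (V α) (Ioi 0)
  cont : ∀ α ∈ Icc 0 A, Continuous (Ψ α)
  apply_zero : ∀ α ∈ Icc 0 A, Ψ α 0 = 0
  tendsto_v : ∀ α ∈ Icc 0 A, Tendsto (V α) (𝓝[>] 0) (𝓝 0)
  hasDerivAt_zero : ∀ α ∈ Icc 0 A, HasDerivAt (Ψ α) α 0
  nonneg : ∀ α ∈ Icc 0 A, ∀ ρ, 0 ≤ ρ → 0 ≤ Ψ α ρ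
  pos : ∀ α ∈ Icc 0 A, 0 < α → ∀ ρ, 0 < ρ → 0 < Ψ α ρ
  le_mul : ∀ α ∈ Icc 0 A, ∀ ρ, 0 ≤ ρ → Ψ α ρ ≤ ρ * α
  lipschitz : ∃ k, 0 ≤ k ∧ ∀ α β ρ, 0 ≤ ρ →
    |Ψ α ρ - Ψ β ρ| ≤ 2 * ρ * Real.exp (k * ρ) * |α - β|
  lower : ∀ ρ, 0 ≤ ρ → ρ * A * (1 - (1 / 2 + 2 * ((d : ℝ) - 1) * A ^ 2) * ρ ^ 2) ≤ Ψ A ρ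

/-- The family is built for `u = ψ / ρ` with a cut-off outside `[0, A]`. As long as `u` is positive
it is nonincreasing, so the cut-off is not active; and `u` stays positive because the flow does not
return to `0`. -/
theorem exists_regularFamily {d : ℕ} (hd : 3 ≤ d) {A : ℝ} (hA : 0 ≤ A) :
    ∃ Ψ V : ℝ → ℝ → ℝ, RegularFamily d A Ψ V := by
  obtain ⟨n, rfl⟩ : ∃ n, d = n + 2 := ⟨d - 2, by omega⟩
  obtain ⟨u, hu, hLip⟩ := exists_fixed_family n hA
  have huc : ∀ α, Continuous (u α) := fun α => (hu α).1
  set J : ℝ → ℝ → ℝ := fun α => slopeOf n A (u α) with hJ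
  have hJc : ∀ α, Continuous (J α) := fun α => continuous_slopeOf hA (huc α)
  have hdu : ∀ α ρ, HasDerivAt (u α) (J α ρ) ρ := fun α ρ => by
    have h1 := (intervalIntegral.integral_hasDerivAt_right ((hJc α).intervalIntegrable 0 ρ)
      (hJc α).stronglyMeasurable.stronglyMeasurableAtFilter (hJc α).continuousAt).const_add α
    exact h1.congr_of_eventuallyEq (Eventually.of_forall (hu α).2)
  have hu0 : ∀ α, u α 0 = α := fun α => by rw [(hu α).2 0]; simp
  have hanti : ∀ α, Antitone (u α) := fun α =>
    antitone_of_deriv_nonpos (fun ρ => (hdu α ρ).differentiableAt)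
      (fun ρ => by rw [(hdu α ρ).deriv]; exact slopeOf_nonpos ρ)
  have hle : ∀ α ρ, 0 ≤ ρ → u α ρ ≤ α := fun α ρ hρ => (hanti α hρ).trans_eq (hu0 α)
  -- where the cut-off is inactive, `ρ * u` solves the equation
  have hflow : ∀ α ρ, 0 < ρ → clampTo A (u α ρ) = u α ρ →
      HasDerivAt (fun r => r * u α r) ((ρ * u α ρ + ρ ^ 2 * J α ρ) / ρ) ρ ∧
      HasDerivAt (fun r => r * u α r + r ^ 2 * J α r)
        ((-(((n + 2 : ℕ) : ℝ) - 2 + ρ ^ 2 / 2) * (ρ * u α ρ + ρ ^ 2 * J α ρ) +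
          (((n + 2 : ℕ) : ℝ) - 1) / 2 * Real.sin (2 * (ρ * u α ρ))) / ρ) ρ := by
    intro α ρ hρ hcl
    have h1 := (hasDerivAt_id' ρ).mul (hdu α ρ)
    refine ⟨h1.congr_deriv (by field_simp), ?_⟩
    refine (h1.add ((hasDerivAt_pow 2 ρ).mul
      (hasDerivAt_slopeOf (n := n) (A := A) (huc α) hρ))).congr_deriv ?_
    have hs : regularSource n ρ (u α ρ) / massWeight n ρ = -u α ρ / 2 +
        ((n : ℝ) + 1) / 2 * (Real.sin (2 * (ρ * u α ρ)) - 2 * ρ * u α ρ) / ρ ^ 3 := by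
      have := (Real.exp_pos (ρ ^ 2 / 4)).ne'
      simp only [regularSource, massWeight, pow_add, mul_assoc]
      field_simp
    rw [hcl, hs]
    simp only [hJ, Nat.cast_add, Nat.cast_ofNat, Nat.add_one_sub_one, pow_one]
    field_simp
    ring
  have hpos : ∀ α ∈ Icc 0 A, 0 < α → ∀ ρ, 0 ≤ ρ → 0 < u α ρ := by
    intro α hα hα0 ρ hρ
    by_contra hcon
    obtain ⟨x, hx, hx0, hxpos⟩ := exists_first_zero hρ (huc α).continuousOn
      (by rwa [hu0 α]) (not_lt.1 hcon)
    have hfl : ExpanderFlow ((n + 2 : ℕ) : ℝ) (fun r => r * u α r)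
        (fun r => r * u α r + r ^ 2 * J α r) (Ioo 0 x) := fun r hr =>
      hflow α r hr.1 (clampTo_of_mem (hxpos r ⟨hr.1.le, hr.2⟩).le ((hle α r hr.1.le).trans hα.2))
    have hc : Continuous fun r => r * u α r := continuous_id.mul (huc α)
    have hcv : Continuous fun r => r * u α r + r ^ 2 * J α r :=
      hc.add ((continuous_pow 2).mul (hJc α))
    refine hfl.ne_zero_of_pos hx.1 (by push_cast; linarith [Nat.cast_nonneg (α := ℝ) n])
      ?_ ?_ hc.continuousAt (fun r hr => mul_pos hr.1 (hxpos r ⟨hr.1.le, hr.2⟩)) (by simp [hx0])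
    · simpa using (hc.tendsto 0).mono_left (nhdsWithin_le_nhds (s := Ioi 0))
    · simpa using (hcv.tendsto 0).mono_left (nhdsWithin_le_nhds (s := Ioi 0))
  have hnn : ∀ α ∈ Icc 0 A, ∀ ρ, 0 ≤ ρ → 0 ≤ u α ρ := by
    intro α hα ρ hρ
    rcases hα.1.eq_or_lt with rfl | hα0
    · have hJ0 : ∀ s, J 0 s = 0 := fun s => by
        rcases le_or_gt s 0 with hs | hs
        · exact slopeOf_of_nonpos hs
        · simp only [hJ]
          rw [slopeOf_of_pos hs, intervalIntegral.integral_congr (g := fun _ => (0 : ℝ))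
            (fun r hr => by
              rw [uIcc_of_le hs.le] at hr
              simp only
              rw [clampTo_of_nonpos hA (hle 0 r hr.1), regularSource_zero])]
          simp
      have := (hu 0).2 ρ
      rw [intervalIntegral.integral_congr (g := fun _ => (0 : ℝ)) (fun r _ => hJ0 r)] at this
      simp at this
      exact this.ge
    · exact (hpos α hα hα0 ρ hρ).le
  have hc : ∀ α, Continuous fun r => r * u α r := fun α => continuous_id.mul (huc α)
  refine ⟨fun α r => r * u α r, fun α r => r * u α r + r ^ 2 * J α r, ?_⟩
  constructor
  case flow =>
    exact fun α hα r hr => hflow α r hr (clampTo_of_mem (hnn α hα r (le_of_lt hr))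
      ((hle α r (le_of_lt hr)).trans hα.2))
  case cont => exact fun α _ => hc α
  case apply_zero => simp
  case tendsto_v =>
    intro α _
    have hcv : Continuous fun r => r * u α r + r ^ 2 * J α r :=
      (hc α).add ((continuous_pow 2).mul (hJc α))
    simpa using (hcv.tendsto 0).mono_left (nhdsWithin_le_nhds (s := Ioi 0))
  case hasDerivAt_zero =>
    exact fun α _ => ((hasDerivAt_id' (0 : ℝ)).mul (hdu α 0)).congr_deriv (by rw [hu0]; ring)
  case nonneg => exact fun α hα ρ hρ => mul_nonneg hρ (hnn α hα ρ hρ)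
  case pos => exact fun α hα h0 ρ hρ => mul_pos hρ (hpos α hα h0 ρ hρ.le)
  case le_mul => exact fun α _ ρ hρ => mul_le_mul_of_nonneg_left (hle α ρ hρ) hρ
  case lipschitz =>
    refine ⟨expRate n A, (expRate_pos n A).le, fun α β ρ hρ => ?_⟩
    rw [← mul_sub, abs_mul, abs_of_nonneg hρ]
    have := mul_le_mul_of_nonneg_left (hLip α β ρ) hρ
    rw [abs_of_nonneg hρ] at this
    linarith
  case lower =>
    intro ρ hρ
    have h1 := (abs_le.1 (abs_integral_slopeOf_le (n := n) (u := u A) hA ρ)).1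
    have h2 := (hu A).2 ρ
    have h3 : lipConst n A = 1 / 2 + 2 * (((n + 2 : ℕ) : ℝ) - 1) * A ^ 2 := by
      simp only [lipConst]
      push_cast
      ring
    rw [← h3]
    have h4 : A * (1 - lipConst n A * ρ ^ 2) ≤ u A ρ := by
      rw [h2]
      linarith
    have := mul_le_mul_of_nonneg_left h4 hρ
    linarith

/-! ### Solutions relative to the equator `π / 2` -/

section Equator

variable {c : ℝ} {ψ v : ℝ → ℝ}

lemma sin_two_mul_pi_div_two_sub (x : ℝ) :
    Real.sin (2 * x) = Real.sin (2 * (Real.pi / 2 - x)) := by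
  rw [show 2 * (Real.pi / 2 - x) = Real.pi - 2 * x by ring, Real.sin_pi_sub]

/-- In dimension at least `7` regular solutions do not reach the equator: `ρ² (π / 2 - ψ)` is
nondecreasing. The exponent `a = 2` satisfies `a² - (d - 2) a + (d - 1) ≤ 0`, an inequality without
real solutions in dimensions `3` to `6`. -/
lemma ExpanderFlow.lt_pi_div_two (hc : 7 ≤ c) (h : ExpanderFlow c ψ v (Ioi 0))
    (hψ : Tendsto ψ (𝓝[>] 0) (𝓝 0)) (hv : Tendsto v (𝓝[>] 0) (𝓝 0))
    (hpos : ∀ ρ, 0 < ρ → 0 < ψ ρ) {ρ : ℝ} (hρ : 0 < ρ) : ψ ρ < Real.pi / 2 := by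
  by_contra hcon
  push Not at hcon
  obtain ⟨δ, hδ, hδs⟩ := mem_nhdsGT_iff_exists_Ioo_subset.1
    ((hψ.eventually (gt_mem_nhds (half_pos Real.pi_pos))).and (Ioo_mem_nhdsGT hρ))
  have hδ : 0 < δ := hδ
  set a := δ / 2 with ha
  have ha0 : 0 < a := half_pos hδ
  have haδ : a < δ := half_lt_self hδ
  have haρ : a < ρ := (hδs ⟨ha0, haδ⟩).2.2
  have hsmall : ∀ r ∈ Ioc 0 a, ψ r < Real.pi / 2 := fun r hr => (hδs ⟨hr.1, hr.2.trans_lt haδ⟩).1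
  have hcont : ContinuousOn ψ (Ioi 0) := fun r hr => (h r hr).1.continuousAt.continuousWithinAt
  obtain ⟨x, hx, hx0, hxpos⟩ := exists_first_zero (f := fun r => Real.pi / 2 - ψ r) haρ.le
    (continuousOn_const.sub (hcont.mono fun t ht => ha0.trans_le ht.1))
    (sub_pos.2 (hsmall a ⟨ha0, le_rfl⟩)) (by linarith)
  have hle : ∀ r ∈ Ioc 0 x, ψ r ≤ Real.pi / 2 := fun r hr => by
    rcases le_total r a with h1 | h1
    · exact (hsmall r ⟨hr.1, h1⟩).le
    · rcases hr.2.lt_or_eq with h2 | rfl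
      · linarith [hxpos r ⟨h1, h2⟩]
      · linarith
  have hvpos : ∀ r ∈ Ioc 0 x, 0 < v r := fun r hr =>
    h.deriv_pos (by linarith) hψ hv (fun t ht => hpos t ht.1) hle hr
  have hs0 : ∀ r ∈ Ioc 0 x, 0 < r ∧ Ioc 0 r ⊆ Ioc 0 x :=
    fun r hr => ⟨hr.1, Ioc_subset_Ioc_right hr.2⟩
  have hg : MonotoneOn (fun r => wt (c - 4) 0 r * (2 * (Real.pi / 2 - ψ r) - v r)) (Ioc 0 x) := by
    refine monotoneOn_wt_mul (convex_Ioc 0 x) (fun r hr => hr.1) (f' := fun r => -2 * v r -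
      (-(c - 2 + r ^ 2 / 2) * v r + (c - 1) / 2 * Real.sin (2 * ψ r))) (fun r hr => ?_)
      (fun r hr => ?_)
    · exact ((((h r hr.1).1.const_sub (Real.pi / 2)).const_mul 2).sub (h r hr.1).2).congr_deriv
        (by ring)
    · have hy : 0 ≤ Real.pi / 2 - ψ r := by linarith [hle r hr]
      have h1 := Real.sin_le (by linarith : 0 ≤ 2 * (Real.pi / 2 - ψ r))
      rw [← sin_two_mul_pi_div_two_sub] at h1
      have h2 : 0 ≤ r ^ 2 * v r := mul_nonneg (sq_nonneg r) (hvpos r hr).le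
      nlinarith
  have hgnn : ∀ r ∈ Ioc 0 x, 0 ≤ 2 * (Real.pi / 2 - ψ r) - v r := fun r hr =>
    nonneg_of_monotoneOn_wt_mul (by linarith) le_rfl hs0
      (by linarith [Real.pi_pos] : 0 ≤ 2 * (Real.pi / 2 - 0) - 0)
      (((hψ.const_sub (Real.pi / 2)).const_mul 2).sub hv) hg hr
  have hy : MonotoneOn (fun r => wt 2 0 r * (Real.pi / 2 - ψ r)) (Ioc 0 x) := by
    refine monotoneOn_wt_mul (convex_Ioc 0 x) (fun r hr => hr.1) (f' := fun r => - v r)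
      (fun r hr => ?_) (fun r hr => ?_)
    · exact ((h r hr.1).1.const_sub (Real.pi / 2)).congr_deriv (by ring)
    · have := hgnn r hr
      linarith
  have h1 := hy ⟨ha0, hx.1.le⟩ ⟨ha0.trans hx.1, le_rfl⟩ hx.1.le
  simp only [hx0, mul_zero] at h1
  have h2 := mul_pos (wt_pos 2 0 a) (sub_pos.2 (hsmall a ⟨ha0, le_rfl⟩))
  linarith

/-- Solutions of large initial slope `A` that stay below the equator are close to it at any given
radius. Away from the equator `ψ` grows at least like a positive power of `ρ`, starting from a
fixed size at radius comparable to `1 / A`. -/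
lemma ExpanderFlow.exists_near_equator (hc : 3 ≤ c) {δ κ ρ₀ η : ℝ} (hδ : 0 < δ) (hκ : 0 < κ)
    (hρ₀ : 0 < ρ₀) (hη : 0 < η) (hη' : η ≤ Real.pi / 2) :
    ∃ A₀, ∀ A, A₀ ≤ A → ∀ ψ v : ℝ → ℝ, ExpanderFlow c ψ v (Ioi 0) →
      Tendsto ψ (𝓝[>] 0) (𝓝 0) → Tendsto v (𝓝[>] 0) (𝓝 0) → (∀ ρ ∈ Ioc 0 ρ₀, 0 < ψ ρ) →
      (∀ ρ ∈ Ioc 0 ρ₀, ψ ρ ≤ Real.pi / 2) → δ ≤ ψ (κ / A) → Real.pi / 2 - η < ψ ρ₀ := by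
  have hsη : 0 < Real.sin η := Real.sin_pos_of_pos_of_lt_pi hη (by linarith [Real.pi_pos])
  set μ := (c - 1) / 2 * (4 / Real.pi * Real.sin η) with hμ
  have hμ0 : 0 < μ := mul_pos (by linarith)
    (mul_pos (div_pos (by norm_num) Real.pi_pos) hsη)
  set γ := c - 2 + ρ₀ ^ 2 / 2 with hγ
  have hγ0 : 0 < γ := by
    have := sq_nonneg ρ₀
    linarith
  obtain ⟨β, hβ0, hβ⟩ : ∃ β : ℝ, 0 < β ∧ β * (β + γ) ≤ μ := by
    refine ⟨min 1 (μ / (1 + γ)), lt_min one_pos (by positivity), ?_⟩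
    have h1 := min_le_left 1 (μ / (1 + γ))
    have h2 := min_le_right 1 (μ / (1 + γ))
    have h3 : 0 ≤ min 1 (μ / (1 + γ)) := le_min zero_le_one (by positivity)
    calc min 1 (μ / (1 + γ)) * (min 1 (μ / (1 + γ)) + γ) ≤ μ / (1 + γ) * (1 + γ) := by gcongr
      _ = μ := by field_simp
  have hlim : Tendsto (fun A : ℝ => δ * Real.exp (β * Real.log (ρ₀ / κ * A))) atTop atTop :=
    ((Real.tendsto_exp_atTop.comp ((Real.tendsto_log_atTop.comp
      (tendsto_id.const_mul_atTop (div_pos hρ₀ hκ))).const_mul_atTop hβ0)).const_mul_atTop hδ)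
  obtain ⟨A₀, hA₀⟩ := eventually_atTop.1 ((hlim.eventually_gt_atTop (Real.pi / 2)).and
    ((eventually_gt_atTop 0).and (eventually_ge_atTop (κ / ρ₀))))
  refine ⟨A₀, fun A hA ψ v h hψ hv hpos hle hAδ => ?_⟩
  obtain ⟨hbig, hA0, hAκ⟩ := hA₀ A hA
  by_contra hcon
  push Not at hcon
  have hs0 : ∀ r ∈ Ioc 0 ρ₀, 0 < r ∧ Ioc 0 r ⊆ Ioc 0 ρ₀ :=
    fun r hr => ⟨hr.1, Ioc_subset_Ioc_right hr.2⟩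
  have hvpos : ∀ r ∈ Ioc 0 ρ₀, 0 < v r := fun r hr => h.deriv_pos (by linarith) hψ hv hpos hle hr
  have hmono : MonotoneOn ψ (Ioc 0 ρ₀) := monotoneOn_of_hasDerivAt_nonneg (convex_Ioc 0 ρ₀)
    (fun r hr => (h r hr.1).1) (fun r hr => div_nonneg (hvpos r hr).le hr.1.le)
  have hsin : ∀ r ∈ Ioc 0 ρ₀, 4 / Real.pi * Real.sin η * ψ r ≤ Real.sin (2 * ψ r) := by
    intro r hr
    have hψη : ψ r ≤ Real.pi / 2 - η := (hmono hr ⟨hρ₀, le_rfl⟩ hr.2).trans hcon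
    have h1 := Real.mul_le_sin (hpos r hr).le (hle r hr)
    have h2 : Real.sin η ≤ Real.cos (ψ r) := by
      rw [← Real.cos_pi_div_two_sub]
      exact Real.cos_le_cos_of_nonneg_of_le_pi (hpos r hr).le (by linarith [Real.pi_pos]) hψη
    rw [Real.sin_two_mul]
    have h3 : 0 ≤ 2 / Real.pi * ψ r := mul_nonneg (by positivity) (hpos r hr).le
    calc 4 / Real.pi * Real.sin η * ψ r = 2 * (2 / Real.pi * ψ r * Real.sin η) := by ring
      _ ≤ 2 * (Real.sin (ψ r) * Real.cos (ψ r)) := by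
          have := mul_le_mul h1 h2 hsη.le (h3.trans h1)
          linarith
      _ = 2 * Real.sin (ψ r) * Real.cos (ψ r) := by ring
  have hg : MonotoneOn (fun r => wt (γ + β) 0 r * (v r - β * ψ r)) (Ioc 0 ρ₀) := by
    refine monotoneOn_wt_mul (convex_Ioc 0 ρ₀) (fun r hr => hr.1) (f' := fun r =>
      -(c - 2 + r ^ 2 / 2) * v r + (c - 1) / 2 * Real.sin (2 * ψ r) - β * v r) (fun r hr => ?_)
      (fun r hr => ?_)
    · exact ((h r hr.1).2.sub ((h r hr.1).1.const_mul β)).congr_deriv (by ring)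
    · have h1 : (c - 2 + r ^ 2 / 2) * v r ≤ γ * v r := by
        refine mul_le_mul_of_nonneg_right ?_ (hvpos r hr).le
        have := pow_le_pow_left₀ hr.1.le hr.2 2
        linarith
      have h2 : μ * ψ r ≤ (c - 1) / 2 * Real.sin (2 * ψ r) := by
        rw [hμ, mul_assoc]
        exact mul_le_mul_of_nonneg_left (hsin r hr) (by linarith)
      have h3 := mul_le_mul_of_nonneg_right hβ (hpos r hr).le
      linarith
  have hgnn : ∀ r ∈ Ioc 0 ρ₀, 0 ≤ v r - β * ψ r := fun r hr =>
    nonneg_of_monotoneOn_wt_mul (by positivity) le_rfl hs0 (by simp : 0 ≤ (0 : ℝ) - β * 0)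
      (hv.sub (hψ.const_mul β)) hg hr
  have hpow : MonotoneOn (fun r => wt (-β) 0 r * ψ r) (Ioc 0 ρ₀) := by
    refine monotoneOn_wt_mul (convex_Ioc 0 ρ₀) (fun r hr => hr.1) (fun r hr => (h r hr.1).1)
      (fun r hr => ?_)
    have := hgnn r hr
    linarith
  have hκA : 0 < κ / A := div_pos hκ hA0
  have hκA' : κ / A ≤ ρ₀ := by
    rw [div_le_iff₀ hρ₀] at hAκ
    rw [div_le_iff₀ hA0]
    linarith
  have h1 := hpow ⟨hκA, hκA'⟩ ⟨hρ₀, le_rfl⟩ hκA'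
  simp only at h1
  have h2 : wt (-β) 0 (κ / A) = wt (-β) 0 ρ₀ * Real.exp (β * Real.log (ρ₀ / κ * A)) := by
    rw [wt, wt, ← Real.exp_add]
    congr 1
    rw [Real.log_div hκ.ne' hA0.ne', Real.log_mul (div_pos hρ₀ hκ).ne' hA0.ne',
      Real.log_div hρ₀.ne' hκ.ne']
    ring
  rw [h2, mul_assoc] at h1
  have h3 := le_of_mul_le_mul_left h1 (wt_pos _ _ _)
  have h4 : δ * Real.exp (β * Real.log (ρ₀ / κ * A)) ≤
      Real.exp (β * Real.log (ρ₀ / κ * A)) * ψ (κ / A) := by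
    rw [mul_comm]
    exact mul_le_mul_of_nonneg_left hAδ (Real.exp_pos _).le
  have h5 := hle ρ₀ ⟨hρ₀, le_rfl⟩
  linarith

/-- In dimensions `3` to `6` the equator is oscillatory at small scales: a regular solution that
stays below it cannot be close to it at a small radius. The phase `arctan` of the shifted quotient
`v / (π / 2 - ψ)` would advance by more than `π`. -/
lemma ExpanderFlow.not_near_equator (hc3 : 3 ≤ c) (hc6 : c ≤ 6)
    (h : ExpanderFlow c ψ v (Ioi 0)) (hψ : Tendsto ψ (𝓝[>] 0) (𝓝 0))
    (hv : Tendsto v (𝓝[>] 0) (𝓝 0)) (hpos : ∀ ρ, 0 < ρ → 0 < ψ ρ)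
    (hle : ∀ ρ, 0 < ρ → ψ ρ ≤ Real.pi / 2)
    (hnear : Real.pi / 2 - 1 / 10 < ψ (2 / 5 * Real.exp (-7))) : False := by
  set ρ₀ := 2 / 5 * Real.exp (-7) with hρ₀
  have hρ₀0 : 0 < ρ₀ := by positivity
  have hρ₀1 : ρ₀ ≤ 2 / 5 := by
    have : Real.exp (-7) ≤ 1 := Real.exp_le_one_iff.2 (by norm_num)
    linarith
  have hvpos : ∀ r, 0 < r → 0 < v r := fun r hr => h.deriv_pos (b := r) (by linarith) hψ hv
    (fun t ht => hpos t ht.1) (fun t ht => hle t ht.1) ⟨hr, le_rfl⟩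
  have hmono : StrictMonoOn ψ (Ioi 0) := strictMonoOn_of_hasDerivAt_pos (convex_Ioi 0)
    (fun r hr => (h r hr).1) (fun r hr => div_pos (hvpos r hr) hr)
  have hlt : ∀ r, 0 < r → ψ r < Real.pi / 2 := fun r hr =>
    (hmono hr (mem_Ioi.2 (by linarith : 0 < r + 1)) (by linarith)).trans_le
      (hle (r + 1) (by linarith))
  have hF : MonotoneOn (fun r => Real.arctan (v r / (Real.pi / 2 - ψ r) - (c - 2) / 2)
      - 1 / 2 * Real.log r) (Icc ρ₀ (2 / 5)) := by
    refine monotoneOn_of_hasDerivAt_nonneg (convex_Icc _ _) (f' := fun r =>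
      (1 / (1 + (v r / (Real.pi / 2 - ψ r) - (c - 2) / 2) ^ 2) *
      ((v r / (Real.pi / 2 - ψ r)) ^ 2 - (c - 2 + r ^ 2 / 2) * (v r / (Real.pi / 2 - ψ r)) +
        (c - 1) / 2 * Real.sin (2 * ψ r) / (Real.pi / 2 - ψ r)) - 1 / 2) / r)
      (fun r hr => ?_) (fun r hr => ?_)
    · have hr0 : 0 < r := hρ₀0.trans_le hr.1
      have hy := (sub_pos.2 (hlt r hr0)).ne'
      refine HasDerivAt.congr_deriv (((((h r hr0).2.div ((h r hr0).1.const_sub (Real.pi / 2))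
        hy).sub_const ((c - 2) / 2)).arctan).sub
        ((Real.hasDerivAt_log hr0.ne').const_mul (1 / 2))) ?_
      simp only [Pi.div_apply]
      generalize 1 / (1 + (v r / (Real.pi / 2 - ψ r) - (c - 2) / 2) ^ 2) = q
      field_simp
      ring
    · have hr0 : 0 < r := hρ₀0.trans_le hr.1
      set y := Real.pi / 2 - ψ r with hy
      have hy0 : 0 < y := sub_pos.2 (hlt r hr0)
      have hy1 : y ≤ 1 / 10 := by
        have := hmono.monotoneOn hρ₀0 hr0 hr.1
        linarith
      set q := v r / y with hq
      have hq0 : 0 < q := div_pos (hvpos r hr0) hy0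
      have hsin : 99 / 100 * (c - 1) ≤ (c - 1) / 2 * Real.sin (2 * ψ r) / y := by
        rw [sin_two_mul_pi_div_two_sub, ← hy, le_div_iff₀ hy0]
        have h1 := Real.sin_gt_sub_cube (x := 2 * y) (by linarith)
        have h2 : 99 / 100 * (2 * y) ≤ Real.sin (2 * y) := by
          have : y ^ 3 ≤ 1 / 100 * y := by nlinarith [mul_pos hy0 hy0]
          nlinarith
        have h3 : 0 ≤ c - 1 := by linarith
        nlinarith
      have hr2 : r ^ 2 ≤ 4 / 25 := by nlinarith [hr.2]
      set X := q - (c - 2) / 2 with hX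
      have hqX : q = X + (c - 2) / 2 := by rw [hX]; ring
      have hdisc : 1 ≤ (c - 1) - (c - 2) ^ 2 / 4 := by
        nlinarith [mul_nonneg (sub_nonneg.2 hc3) (sub_nonneg.2 hc6)]
      have hmain : (1 + X ^ 2) / 2 ≤ q ^ 2 - (c - 2 + r ^ 2 / 2) * q +
          (c - 1) / 2 * Real.sin (2 * ψ r) / y := by
        have h1 : r ^ 2 / 2 * q ≤ 2 / 25 * q := by nlinarith
        have h2 : q ^ 2 - (c - 2) * q = X ^ 2 - (c - 2) ^ 2 / 4 := by rw [hqX]; ring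
        nlinarith [sq_nonneg (X - 1 / 10)]
      refine div_nonneg ?_ hr0.le
      have hX1 : 0 < 1 + X ^ 2 := by positivity
      rw [sub_nonneg, one_div_mul_eq_div, le_div_iff₀ hX1]
      linarith
  have h1 := hF (left_mem_Icc.2 hρ₀1) (right_mem_Icc.2 hρ₀1) hρ₀1
  simp only at h1
  have h2 : Real.log ρ₀ = Real.log (2 / 5) - 7 := by
    rw [hρ₀, Real.log_mul (by norm_num) (Real.exp_pos _).ne', Real.log_exp]
    ring
  rw [h2] at h1
  have h3 := Real.arctan_lt_pi_div_two
    (v (2 / 5) / (Real.pi / 2 - ψ (2 / 5)) - (c - 2) / 2)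
  have h4 := Real.neg_pi_div_two_lt_arctan (v ρ₀ / (Real.pi / 2 - ψ ρ₀) - (c - 2) / 2)
  linarith [Real.pi_lt_d2]

/-- Beyond radius `2` the equator is not oscillatory: after an upward crossing a solution stays
above it, also in the limit. The comparison function is `1 / ρ`. -/
lemma ExpanderFlow.stays_above_equator (hc : 3 ≤ c) (h : ExpanderFlow c ψ v (Ioi 0)) {ρ₁ : ℝ}
    (hρ₁ : 2 ≤ ρ₁) (hψ₁ : ψ ρ₁ = Real.pi / 2) (hv₁ : 0 < v ρ₁) :
    (∀ ρ, ρ₁ < ρ → Real.pi / 2 < ψ ρ) ∧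
      ∀ l, Tendsto ψ atTop (𝓝 l) → Real.pi / 2 < l := by
  have h0 : ∀ r, ρ₁ ≤ r → 0 < r := fun r hr => by linarith
  have hsin : ∀ r, Real.sin (2 * ψ r) = -Real.sin (2 * (ψ r - Real.pi / 2)) := fun r => by
    rw [show 2 * (ψ r - Real.pi / 2) = 2 * ψ r - Real.pi by ring, Real.sin_sub_pi, neg_neg]
  -- on any interval where `ψ ≥ π / 2`, `ρ (ψ - π / 2)` is increasing
  have key : ∀ s : Set ℝ, Convex ℝ s → s ⊆ Ici ρ₁ → ρ₁ ∈ s →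
      (∀ r ∈ s, 0 ≤ ψ r - Real.pi / 2) →
      MonotoneOn (fun r => wt 1 0 r * (ψ r - Real.pi / 2)) s := by
    intro s hs hsub hmem hnn
    have hm : MonotoneOn (fun r => wt (c - 3) 1 r * (v r + (ψ r - Real.pi / 2))) s := by
      refine monotoneOn_wt_mul hs (fun r hr => h0 r (hsub hr)) (f' := fun r =>
        -(c - 2 + r ^ 2 / 2) * v r + (c - 1) / 2 * Real.sin (2 * ψ r) + v r)
        (fun r hr => ?_) (fun r hr => ?_)
      · have hr0 := h0 r (hsub hr)
        exact ((h r hr0).2.add ((h r hr0).1.sub_const (Real.pi / 2))).congr_deriv (by ring)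
      · have hr1 : ρ₁ ≤ r := hsub hr
        have h1 := Real.sin_le (by linarith [hnn r hr] : 0 ≤ 2 * (ψ r - Real.pi / 2))
        have h2 : 0 ≤ (r ^ 2 / 2 - 2) * (ψ r - Real.pi / 2) :=
          mul_nonneg (by nlinarith) (hnn r hr)
        rw [hsin]
        nlinarith
    refine monotoneOn_wt_mul hs (fun r hr => h0 r (hsub hr))
      (fun r hr => (h r (h0 r (hsub hr))).1.sub_const _) (fun r hr => ?_)
    have h1 := hm hmem hr (hsub hr)
    simp only [hψ₁, sub_self, add_zero] at h1
    have h2 : 0 < wt (c - 3) 1 r * (v r + (ψ r - Real.pi / 2)) :=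
      (mul_pos (wt_pos _ _ _) hv₁).trans_le h1
    have h3 := pos_of_mul_pos_right h2 (wt_pos _ _ _).le
    linarith
  have habove : ∀ ρ, ρ₁ < ρ → Real.pi / 2 < ψ ρ := by
    intro ρ hρ
    by_contra hcon
    push Not at hcon
    have hvc : ContinuousAt v ρ₁ := (h ρ₁ (h0 _ le_rfl)).2.continuousAt
    obtain ⟨ε, hε, hεs⟩ := Metric.eventually_nhds_iff.1 (hvc.eventually (lt_mem_nhds hv₁))
    obtain ⟨a, ha, ha'⟩ := exists_between (lt_min hρ (lt_add_of_pos_right ρ₁ hε))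
    have haρ : a < ρ := ha'.trans_le (min_le_left _ _)
    have hinc : StrictMonoOn ψ (Icc ρ₁ a) := strictMonoOn_of_hasDerivAt_pos (convex_Icc _ _)
      (fun r hr => (h r (h0 r hr.1)).1) (fun r hr => div_pos (hεs (by
        have := ha'.trans_le (min_le_right _ _)
        rw [Real.dist_eq, abs_of_nonneg (by linarith [hr.1])]
        linarith [hr.2])) (h0 r hr.1))
    have haψ : ∀ r ∈ Ioc ρ₁ a, 0 < ψ r - Real.pi / 2 := fun r hr => by
      have := hinc (left_mem_Icc.2 ha.le) ⟨hr.1.le, hr.2⟩ hr.1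
      linarith
    obtain ⟨x, hx, hx0, hxpos⟩ := exists_first_zero (f := fun r => ψ r - Real.pi / 2) haρ.le
      (fun t ht => ((h t (h0 t (ha.le.trans ht.1))).1.continuousAt.sub
        continuousAt_const).continuousWithinAt) (haψ a ⟨ha, le_rfl⟩) (by linarith)
    have hm := key (Icc ρ₁ x) (convex_Icc _ _) (fun r hr => hr.1)
      (left_mem_Icc.2 (ha.trans hx.1).le) (fun r hr => by
        rcases hr.1.lt_or_eq with h1 | rfl
        · rcases le_or_gt r a with h2 | h2
          · exact (haψ r ⟨h1, h2⟩).le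
          · rcases hr.2.lt_or_eq with h3 | rfl
            · exact (hxpos r ⟨h2.le, h3⟩).le
            · exact hx0.ge
        · rw [hψ₁, sub_self])
    have h1 := hm ⟨ha.le, hx.1.le⟩ ⟨(ha.trans hx.1).le, le_rfl⟩ hx.1.le
    simp only [hx0, mul_zero] at h1
    have h2 := mul_pos (wt_pos 1 0 a) (haψ a ⟨ha, le_rfl⟩)
    linarith
  refine ⟨habove, fun l hl => ?_⟩
  have hge : Real.pi / 2 ≤ l := ge_of_tendsto hl (by
    filter_upwards [eventually_gt_atTop ρ₁] with r hr using (habove r hr).le)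
  refine hge.lt_of_ne ?_
  rintro rfl
  have hm := key (Ici ρ₁) (convex_Ici _) subset_rfl self_mem_Ici (fun r hr => by
    rcases (mem_Ici.1 hr).lt_or_eq with h1 | rfl
    · linarith [habove r h1]
    · rw [hψ₁, sub_self])
  have hR : ∀ r, ρ₁ + 1 ≤ r → ρ₁ < r ∧ 0 < r := fun r hr => ⟨by linarith, by linarith⟩
  obtain ⟨K, -, hev⟩ := decay_of_tendsto_zero (c := c) (C := c - 1) (R := ρ₁ + 1)
    (z := fun r => ψ r - Real.pi / 2) (ζ := v)
    (r := fun r => (c - 1) / 2 * Real.sin (2 * ψ r)) (by linarith) (by linarith)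
    (fun r hr => (h r (hR r hr).2).1.sub_const _) (fun r hr => (h r (hR r hr).2).2)
    (fun r hr => by
      have h1 := habove r (hR r hr).1
      have h2 := Real.sin_le (by linarith : 0 ≤ 2 * (ψ r - Real.pi / 2))
      rw [hsin]
      nlinarith)
    (fun r hr => by linarith [habove r (hR r hr).1]) (by simpa using hl.sub_const (Real.pi / 2))
  have hbase : 0 < wt 1 0 (ρ₁ + 1) * (ψ (ρ₁ + 1) - Real.pi / 2) :=
    mul_pos (wt_pos _ _ _) (by linarith [habove (ρ₁ + 1) (by linarith)])
  have hub : ∀ᶠ r in atTop, wt 1 0 (ρ₁ + 1) * (ψ (ρ₁ + 1) - Real.pi / 2) ≤ K / r ^ 2 := by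
    filter_upwards [hev, eventually_ge_atTop (ρ₁ + 1)] with r h1 h2
    have h3 := hm (mem_Ici.2 (by linarith : ρ₁ ≤ ρ₁ + 1)) (mem_Ici.2 (by linarith : ρ₁ ≤ r)) h2
    refine h3.trans (le_trans ?_ h1.2)
    refine mul_le_mul_of_nonneg_right (Real.exp_le_exp.2 ?_) (by linarith [habove r (hR r h2).1])
    have h4 : 0 ≤ Real.log r := Real.log_nonneg (by linarith)
    nlinarith [sq_nonneg r]
  have hlim0 : Tendsto (fun r : ℝ => K / r ^ 2) atTop (𝓝 0) :=
    tendsto_const_nhds.div_atTop (tendsto_pow_atTop two_ne_zero)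
  exact absurd (ge_of_tendsto hlim0 hub) (not_le.2 hbase)

end Equator

/-! ### The family as the initial slope varies -/

namespace RegularFamily

variable {d : ℕ} {A : ℝ} {Ψ V : ℝ → ℝ → ℝ}

lemma tendsto_zero (F : RegularFamily d A Ψ V) {α : ℝ} (hα : α ∈ Icc 0 A) :
    Tendsto (Ψ α) (𝓝[>] 0) (𝓝 0) := by
  have := ((F.cont α hα).tendsto 0).mono_left (nhdsWithin_le_nhds (s := Ioi 0))
  rwa [F.apply_zero α hα] at this

lemma isProfile (F : RegularFamily d A Ψ V) {α l : ℝ} (hα : α ∈ Icc 0 A)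
    (hl : Tendsto (Ψ α) atTop (𝓝 l)) : IsProfile d l (Ψ α) :=
  ⟨(F.cont α hα).continuousOn, (F.flow α hα).solves, hl⟩

lemma northPole (F : RegularFamily d A Ψ V) {α : ℝ} (hα : α ∈ Icc 0 A) : NorthPole (Ψ α) :=
  ⟨F.apply_zero α hα, α, (F.hasDerivAt_zero α hα).hasDerivWithinAt⟩

lemma exists_limit (F : RegularFamily d A Ψ V) (hd : 3 ≤ d) {α : ℝ} (hα : α ∈ Icc 0 A) :
    ∃ l, Tendsto (Ψ α) atTop (𝓝 l) :=
  (F.flow α hα).exists_tendsto (by exact_mod_cast hd) (F.tendsto_zero hα) (F.tendsto_v α hα)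

/-- The solutions depend on `α` uniformly on all of `[0, ∞)`: locally by the Lipschitz bound, far
out because they settle at a uniform rate. -/
lemma uniform (F : RegularFamily d A Ψ V) (hd : 3 ≤ d) {ε : ℝ} (hε : 0 < ε) :
    ∃ δ > 0, ∀ α ∈ Icc 0 A, ∀ β ∈ Icc 0 A, |α - β| < δ → ∀ ρ, 0 ≤ ρ →
      |Ψ α ρ - Ψ β ρ| ≤ ε := by
  have hd3 : (3 : ℝ) ≤ d := by exact_mod_cast hd
  obtain ⟨k, hk, hL⟩ := F.lipschitz
  obtain ⟨R, hR1, hR⟩ : ∃ R : ℝ, 1 ≤ R ∧ ((d : ℝ) - 1) / R ≤ ε / 4 := by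
    refine ⟨max 1 (((d : ℝ) - 1) / (ε / 4)), le_max_left _ _, ?_⟩
    rw [div_le_comm₀ (lt_max_of_lt_left one_pos) (by positivity)]
    exact le_max_right _ _
  have hR0 : 0 < R := one_pos.trans_le hR1
  set B := 2 * R * Real.exp (k * R) with hB
  have hB0 : 0 < B := by positivity
  refine ⟨ε / 2 / B, by positivity, fun α hα β hβ hαβ => ?_⟩
  have hloc : ∀ ρ, 0 ≤ ρ → ρ ≤ R → |Ψ α ρ - Ψ β ρ| ≤ ε / 2 := fun ρ h0 hρR => by
    refine (hL α β ρ h0).trans ?_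
    have h1 : 2 * ρ * Real.exp (k * ρ) ≤ B := by
      rw [hB]
      gcongr
    rw [lt_div_iff₀ hB0] at hαβ
    nlinarith [abs_nonneg (α - β)]
  intro ρ hρ
  rcases le_total ρ R with h | h
  · linarith [hloc ρ hρ h]
  · have h1 := abs_le.1 ((F.flow α hα).abs_sub_le hd3 (F.tendsto_zero hα) (F.tendsto_v α hα) hR1 h)
    have h2 := abs_le.1 ((F.flow β hβ).abs_sub_le hd3 (F.tendsto_zero hβ) (F.tendsto_v β hβ) hR1 h)
    have h3 := abs_le.1 (hloc R hR0.le le_rfl)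
    exact abs_le.2 ⟨by linarith [h1.1, h2.2, h3.1], by linarith [h1.2, h2.1, h3.2]⟩

end RegularFamily

/-- The supremum over `[0, ∞)`. -/
noncomputable def halfLineSup (f : ℝ → ℝ) : ℝ := ⨆ ρ : Ici (0 : ℝ), f ρ

namespace RegularFamily

variable {d : ℕ} {A : ℝ} {Ψ V : ℝ → ℝ → ℝ}

lemma bddAbove (F : RegularFamily d A Ψ V) (hd : 3 ≤ d) {α : ℝ} (hα : α ∈ Icc 0 A) :
    BddAbove (range fun ρ : Ici (0 : ℝ) => Ψ α ρ) := by
  have hd3 : (3 : ℝ) ≤ d := by exact_mod_cast hd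
  refine ⟨α + ((d : ℝ) - 1), ?_⟩
  rintro _ ⟨⟨ρ, hρ⟩, rfl⟩
  have hρ : 0 ≤ ρ := hρ
  simp only
  rcases le_total ρ 1 with h | h
  · have := F.le_mul α hα ρ hρ
    nlinarith [hα.1]
  · have h1 := (abs_le.1 ((F.flow α hα).abs_sub_le hd3 (F.tendsto_zero hα) (F.tendsto_v α hα)
      le_rfl h)).2
    have h2 := F.le_mul α hα 1 zero_le_one
    rw [div_one] at h1
    linarith

lemma le_halfLineSup (F : RegularFamily d A Ψ V) (hd : 3 ≤ d) {α : ℝ} (hα : α ∈ Icc 0 A) {ρ : ℝ}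
    (hρ : 0 ≤ ρ) : Ψ α ρ ≤ halfLineSup (Ψ α) :=
  le_ciSup (F.bddAbove hd hα) ⟨ρ, hρ⟩

lemma halfLineSup_le {f : ℝ → ℝ} {m : ℝ} (h : ∀ ρ, 0 ≤ ρ → f ρ ≤ m) : halfLineSup f ≤ m :=
  ciSup_le fun ρ => h ρ ρ.2

lemma continuousOn_halfLineSup (F : RegularFamily d A Ψ V) (hd : 3 ≤ d) :
    ContinuousOn (fun α => halfLineSup (Ψ α)) (Icc 0 A) := by
  refine Metric.continuousOn_iff.2 fun β hβ ε hε => ?_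
  obtain ⟨δ, hδ, h⟩ := F.uniform hd (half_pos hε)
  refine ⟨δ, hδ, fun α hα hαβ => ?_⟩
  rw [Real.dist_eq] at hαβ ⊢
  refine lt_of_le_of_lt (abs_le.2 ⟨?_, ?_⟩) (half_lt_self hε)
  · have : halfLineSup (Ψ β) ≤ halfLineSup (Ψ α) + ε / 2 := halfLineSup_le fun ρ hρ => by
      linarith [(abs_le.1 (h α hα β hβ hαβ ρ hρ)).1, F.le_halfLineSup hd hα hρ]
    linarith
  · have : halfLineSup (Ψ α) ≤ halfLineSup (Ψ β) + ε / 2 := halfLineSup_le fun ρ hρ => by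
      linarith [(abs_le.1 (h α hα β hβ hαβ ρ hρ)).2, F.le_halfLineSup hd hβ hρ]
    linarith

lemma halfLineSup_zero_le (F : RegularFamily d A Ψ V) (hA : 0 ≤ A) : halfLineSup (Ψ 0) ≤ 0 :=
  halfLineSup_le fun ρ hρ => by simpa using F.le_mul 0 ⟨le_rfl, hA⟩ ρ hρ

/-- A member of the family that stays below the equator increases to its supremum. -/
lemma tendsto_halfLineSup (F : RegularFamily d A Ψ V) (hd : 3 ≤ d) {α : ℝ} (hα : α ∈ Icc 0 A)
    (hle : ∀ ρ, 0 ≤ ρ → Ψ α ρ ≤ Real.pi / 2) :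
    MonotoneOn (Ψ α) (Ioi 0) ∧ Tendsto (Ψ α) atTop (𝓝 (halfLineSup (Ψ α))) := by
  have hd3 : (3 : ℝ) ≤ d := by exact_mod_cast hd
  have hmono : MonotoneOn (Ψ α) (Ioi 0) := by
    rcases hα.1.eq_or_lt with rfl | h0
    · have hz : ∀ ρ, 0 ≤ ρ → Ψ 0 ρ = 0 := fun ρ hρ =>
        le_antisymm (by simpa using F.le_mul 0 hα ρ hρ) (F.nonneg 0 hα ρ hρ)
      intro x hx y hy _
      rw [hz x (le_of_lt hx), hz y (le_of_lt hy)]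
    · exact monotoneOn_of_hasDerivAt_nonneg (convex_Ioi 0) (fun r hr => (F.flow α hα r hr).1)
        (fun r hr => div_nonneg ((F.flow α hα).deriv_pos (b := r) (by linarith) (F.tendsto_zero hα)
          (F.tendsto_v α hα) (fun t ht => F.pos α hα h0 t ht.1) (fun t ht => hle t ht.1.le)
          ⟨hr, le_rfl⟩).le (le_of_lt hr))
  refine ⟨hmono, ?_⟩
  obtain ⟨l, hl⟩ := F.exists_limit hd hα
  have h1 : l ≤ halfLineSup (Ψ α) := le_of_tendsto hl (by
    filter_upwards [eventually_ge_atTop 0] with ρ hρ using F.le_halfLineSup hd hα hρ)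
  have h2 : halfLineSup (Ψ α) ≤ l := halfLineSup_le fun ρ hρ => by
    rcases hρ.eq_or_lt with rfl | h0
    · rw [F.apply_zero α hα]
      refine ge_of_tendsto hl ?_
      filter_upwards [eventually_ge_atTop 0] with r hr using F.nonneg α hα r hr
    · refine ge_of_tendsto hl ?_
      filter_upwards [eventually_ge_atTop ρ] with r hr using hmono h0 (h0.trans_le hr) hr
  rwa [le_antisymm h1 h2] at hl

/-- Every limit in `[0, π / 2]` up to the supremum of the last member is attained by a member of the
family that stays below its limit. -/
lemma exists_profile (F : RegularFamily d A Ψ V) (hd : 3 ≤ d) (hA : 0 ≤ A) {l : ℝ} (hl0 : 0 ≤ l)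
    (hl : l ≤ Real.pi / 2) (hlA : l ≤ halfLineSup (Ψ A)) :
    ∃ ψ, IsProfile d l ψ ∧ NorthPole ψ ∧ MapsTo ψ (Ici 0) (Icc 0 (Real.pi / 2)) := by
  obtain ⟨α, hα, hαl⟩ := intermediate_value_Icc hA (F.continuousOn_halfLineSup hd)
    ⟨(F.halfLineSup_zero_le hA).trans hl0, hlA⟩
  simp only at hαl
  have hle : ∀ ρ, 0 ≤ ρ → Ψ α ρ ≤ Real.pi / 2 := fun ρ hρ =>
    (F.le_halfLineSup hd hα hρ).trans (hαl.trans_le hl)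
  have h1 := (F.tendsto_halfLineSup hd hα hle).2
  rw [hαl] at h1
  exact ⟨Ψ α, F.isProfile hα h1, F.northPole hα, fun ρ hρ => ⟨F.nonneg α hα ρ hρ, hle ρ hρ⟩⟩

/-- The lower bound near the origin at radius `1 / (d A)`. -/
lemma le_apply_inv (F : RegularFamily d A Ψ V) (hd : 3 ≤ d) (hA : 1 ≤ A) :
    1 / (2 * (d : ℝ)) ≤ Ψ A (1 / d / A) := by
  have hd3 : (3 : ℝ) ≤ d := by exact_mod_cast hd
  have hd0 : (0 : ℝ) < d := by linarith
  have hA0 : 0 < A := by linarith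
  refine le_trans ?_ (F.lower (1 / d / A) (by positivity))
  have h1 : (1 / 2 + 2 * ((d : ℝ) - 1) * A ^ 2) * (1 / d / A) ^ 2 ≤ 1 / 2 := by
    have e : (1 / 2 + 2 * ((d : ℝ) - 1) * A ^ 2) * (1 / d / A) ^ 2
        = (1 / 2 + 2 * ((d : ℝ) - 1) * A ^ 2) / (d ^ 2 * A ^ 2) := by field_simp
    rw [e, div_le_iff₀ (by positivity)]
    have h2 : 1 ≤ A ^ 2 := one_le_pow₀ hA
    have h3 : 0 ≤ ((d : ℝ) - 1) * (d - 3) := mul_nonneg (by linarith) (by linarith)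
    nlinarith [mul_nonneg h3 (sq_nonneg A)]
  have h2 : 1 / (d : ℝ) / A * A = 1 / d := by field_simp
  rw [h2]
  have h3 : 1 / (2 * (d : ℝ)) = 1 / d * (1 / 2) := by field_simp
  rw [h3]
  exact mul_le_mul_of_nonneg_left (by linarith) (by positivity)

end RegularFamily

/-- For large `A` the last member of the family, if it stays below the equator, is close to it at
radius `ρ₀`. -/
lemma exists_regularFamily_near_equator {d : ℕ} (hd : 3 ≤ d) {ρ₀ η : ℝ} (hρ₀ : 0 < ρ₀)
    (hη : 0 < η) (hη' : η ≤ Real.pi / 2) :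
    ∃ A Ψ V, 0 < A ∧ RegularFamily d A Ψ V ∧
      ((∀ ρ, 0 < ρ → Ψ A ρ ≤ Real.pi / 2) → Real.pi / 2 - η < Ψ A ρ₀) := by
  have hd3 : (3 : ℝ) ≤ d := by exact_mod_cast hd
  have hd0 : (0 : ℝ) < d := by linarith
  obtain ⟨A₀, hA₀⟩ := ExpanderFlow.exists_near_equator (c := d) hd3
    (δ := 1 / (2 * (d : ℝ))) (κ := 1 / d) (by positivity) (by positivity) hρ₀ hη hη'
  have hA1 : 1 ≤ max A₀ 1 := le_max_right _ _
  have hA0 : 0 < max A₀ 1 := one_pos.trans_le hA1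
  obtain ⟨Ψ, V, F⟩ := exists_regularFamily hd hA0.le
  have hmem : max A₀ 1 ∈ Icc 0 (max A₀ 1) := right_mem_Icc.2 hA0.le
  exact ⟨_, Ψ, V, hA0, F, fun hle => hA₀ _ (le_max_left _ _) _ _ (F.flow _ hmem)
    (F.tendsto_zero hmem) (F.tendsto_v _ hmem) (fun ρ hρ => F.pos _ hmem hA0 ρ hρ.1)
    (fun ρ hρ => hle ρ hρ.1) (F.le_apply_inv hd hA1)⟩

/-- In dimensions `3` to `6` solutions of large slope cross the equator. -/
lemma exists_regularFamily_crossing {d : ℕ} (hd : 3 ≤ d) (hd6 : d ≤ 6) :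
    ∃ A Ψ V, 0 < A ∧ RegularFamily d A Ψ V ∧ Real.pi / 2 < halfLineSup (Ψ A) := by
  obtain ⟨A, Ψ, V, hA, F, hnear⟩ := exists_regularFamily_near_equator hd
    (ρ₀ := 2 / 5 * Real.exp (-7)) (η := 1 / 10) (by positivity) (by norm_num)
    (by linarith [Real.pi_gt_three])
  have hmem : A ∈ Icc 0 A := right_mem_Icc.2 hA.le
  refine ⟨A, Ψ, V, hA, F, ?_⟩
  by_contra hcon
  have hle : ∀ ρ, 0 < ρ → Ψ A ρ ≤ Real.pi / 2 := fun ρ hρ =>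
    (F.le_halfLineSup hd hmem hρ.le).trans (not_lt.1 hcon)
  exact (F.flow A hmem).not_near_equator (by exact_mod_cast hd) (by exact_mod_cast hd6)
    (F.tendsto_zero hmem) (F.tendsto_v A hmem) (fun ρ hρ => F.pos A hmem hA ρ hρ) hle (hnear hle)

/-- In dimensions `3` to `6` the regular solutions just past the last one with supremum `π / 2`
cross the equator once, beyond radius `2`, and their limits fill an interval above `π / 2`. -/
lemma exists_crossing_profiles {d : ℕ} (hd : 3 ≤ d) (hd6 : d ≤ 6) :
    ∃ m, Real.pi / 2 < m ∧ ∀ l, Real.pi / 2 < l → l ≤ m → ∃ ψ, IsProfile d l ψ ∧ NorthPole ψ ∧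
      ∃ x, 0 < x ∧ ψ x = Real.pi / 2 ∧ (∀ ρ ∈ Ico 0 x, ψ ρ < Real.pi / 2) ∧
        ∀ ρ ∈ Ioi x, Real.pi / 2 < ψ ρ := by
  have hd3 : (3 : ℝ) ≤ d := by exact_mod_cast hd
  obtain ⟨A, Ψ, V, hA, F, hcross⟩ := exists_regularFamily_crossing hd hd6
  have hM := F.continuousOn_halfLineSup hd
  have hpi : 0 < Real.pi / 2 := half_pos Real.pi_pos
  -- the last slope for which the supremum equals `π / 2`
  obtain ⟨a, ⟨ha, haM⟩, hmax⟩ : ∃ a, IsGreatest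
      (Icc 0 A ∩ (fun α => halfLineSup (Ψ α)) ⁻¹' {Real.pi / 2}) a := by
    refine IsCompact.exists_isGreatest (isCompact_Icc.of_isClosed_subset
      (hM.preimage_isClosed_of_isClosed isClosed_Icc isClosed_singleton) inter_subset_left) ?_
    obtain ⟨α, hα, hαM⟩ := intermediate_value_Icc hA.le hM
      ⟨(F.halfLineSup_zero_le hA.le).trans hpi.le, hcross.le⟩
    exact ⟨α, hα, hαM⟩
  have haM : halfLineSup (Ψ a) = Real.pi / 2 := haM
  have hbig : ∀ α ∈ Icc 0 A, a < α → Real.pi / 2 < halfLineSup (Ψ α) := by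
    intro α hα haα
    by_contra hcon
    obtain ⟨β, hβ, hβM⟩ := intermediate_value_Icc hα.2
      (hM.mono (Icc_subset_Icc_left hα.1)) ⟨not_lt.1 hcon, hcross.le⟩
    have := hmax ⟨⟨hα.1.trans hβ.1, hβ.2⟩, hβM⟩
    linarith [hβ.1]
  have haA : a < A := ha.2.lt_of_ne (by rintro rfl; linarith)
  have ha0 : 0 < a := ha.1.lt_of_ne (by
    rintro rfl
    linarith [F.halfLineSup_zero_le hA.le])
  have hale : ∀ ρ, 0 ≤ ρ → Ψ a ρ ≤ Real.pi / 2 := fun ρ hρ =>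
    (F.le_halfLineSup hd ha hρ).trans haM.le
  obtain ⟨hamono, hatend⟩ := F.tendsto_halfLineSup hd ha hale
  rw [haM] at hatend
  have hastrict : StrictMonoOn (Ψ a) (Ioi 0) := strictMonoOn_of_hasDerivAt_pos (convex_Ioi 0)
    (fun r hr => (F.flow a ha r hr).1)
    (fun r hr => div_pos ((F.flow a ha).deriv_pos (b := r) (by linarith) (F.tendsto_zero ha)
      (F.tendsto_v a ha) (fun t ht => F.pos a ha ha0 t ht.1) (fun t ht => hale t ht.1.le)
      ⟨hr, le_rfl⟩) hr)
  have ha2 : Ψ a 2 < Real.pi / 2 :=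
    (hastrict (mem_Ioi.2 two_pos) (mem_Ioi.2 (by norm_num : (0 : ℝ) < 3)) (by norm_num)).trans_le
      (hale 3 (by norm_num))
  obtain ⟨δ, hδ, hunif⟩ := F.uniform hd (half_pos (sub_pos.2 ha2))
  set b := min A (a + δ / 2) with hb
  have hab : a < b := lt_min haA (by linarith)
  have hmem : ∀ α ∈ Icc a b, α ∈ Icc 0 A := fun α hα =>
    ⟨ha.1.trans hα.1, hα.2.trans (min_le_left _ _)⟩
  have hbelow : ∀ α ∈ Icc a b, ∀ ρ ∈ Icc (0 : ℝ) 2, Ψ α ρ < Real.pi / 2 := by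
    intro α hα ρ hρ
    have h1 := (abs_le.1 (hunif α (hmem α hα) a ha (by
      rw [abs_of_nonneg (by linarith [hα.1])]
      linarith [hα.2, min_le_right A (a + δ / 2)]) ρ hρ.1)).2
    have h2 : Ψ a ρ ≤ Ψ a 2 := by
      rcases hρ.1.eq_or_lt with rfl | h0
      · rw [F.apply_zero a ha]
        exact F.nonneg a ha 2 two_pos.le
      · exact hamono h0 (mem_Ioi.2 two_pos) hρ.2
    linarith
  choose! L hL using fun α (hα : α ∈ Icc 0 A) => F.exists_limit hd hα
  have hLcont : ContinuousOn L (Icc a b) := by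
    refine Metric.continuousOn_iff.2 fun β hβ ε hε => ?_
    obtain ⟨δ', hδ', h⟩ := F.uniform hd (half_pos hε)
    refine ⟨δ', hδ', fun α hα hαβ => ?_⟩
    rw [Real.dist_eq] at hαβ ⊢
    refine lt_of_le_of_lt (le_of_tendsto ((hL α (hmem α hα)).sub (hL β (hmem β hβ))).abs ?_)
      (half_lt_self hε)
    filter_upwards [eventually_ge_atTop 0] with ρ hρ
      using h α (hmem α hα) β (hmem β hβ) hαβ ρ hρ
  have hLa : L a = Real.pi / 2 := tendsto_nhds_unique (hL a ha) hatend
  have hmain : ∀ α ∈ Ioc a b, Real.pi / 2 < L α ∧ ∃ x, 0 < x ∧ Ψ α x = Real.pi / 2 ∧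
      (∀ ρ ∈ Ico 0 x, Ψ α ρ < Real.pi / 2) ∧ ∀ ρ ∈ Ioi x, Real.pi / 2 < Ψ α ρ := by
    intro α hα
    have hα' : α ∈ Icc a b := ⟨hα.1.le, hα.2⟩
    have hαA := hmem α hα'
    obtain ⟨r, hr0, hr⟩ : ∃ r, 0 ≤ r ∧ Real.pi / 2 < Ψ α r := by
      by_contra hcon
      push Not at hcon
      exact absurd (RegularFamily.halfLineSup_le hcon) (not_le.2 (hbig α hαA hα.1))
    have hr2 : 2 < r := by
      by_contra hcon
      linarith [hbelow α hα' r ⟨hr0, not_lt.1 hcon⟩]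
    obtain ⟨x, hx, hx0, hxpos⟩ := exists_first_zero (f := fun ρ => Real.pi / 2 - Ψ α ρ) hr2.le
      (continuous_const.sub (F.cont α hαA)).continuousOn
      (sub_pos.2 (hbelow α hα' 2 ⟨two_pos.le, le_rfl⟩)) (by linarith)
    have hxb : ∀ ρ ∈ Ico 0 x, Ψ α ρ < Real.pi / 2 := fun ρ hρ => by
      rcases le_total ρ 2 with h | h
      · exact hbelow α hα' ρ ⟨hρ.1, h⟩
      · linarith [hxpos ρ ⟨h, hρ.2⟩]
    have hxeq : Ψ α x = Real.pi / 2 := by linarith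
    have hx00 : 0 < x := by linarith [hx.1]
    have hvx : 0 < V α x := (F.flow α hαA).deriv_pos (by linarith) (F.tendsto_zero hαA)
      (F.tendsto_v α hαA) (fun t ht => F.pos α hαA (ha0.trans hα.1) t ht.1)
      (fun t ht => by
        rcases ht.2.lt_or_eq with h | rfl
        · exact (hxb t ⟨ht.1.le, h⟩).le
        · exact hxeq.le) ⟨hx00, le_rfl⟩
    obtain ⟨h1, h2⟩ := (F.flow α hαA).stays_above_equator hd3 hx.1.le hxeq hvx
    exact ⟨h2 _ (hL α hαA), x, hx00, hxeq, hxb, fun ρ hρ => h1 ρ hρ⟩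
  refine ⟨L b, (hmain b ⟨hab, le_rfl⟩).1, fun l hl hlb => ?_⟩
  obtain ⟨α, hα, rfl⟩ := intermediate_value_Icc hab.le hLcont ⟨hLa.trans_le hl.le, hlb⟩
  have hαa : a < α := hα.1.lt_of_ne (by rintro rfl; linarith)
  exact ⟨Ψ α, F.isProfile (hmem α hα) (hL α (hmem α hα)), F.northPole (hmem α hα),
    (hmain α ⟨hαa, hα.2⟩).2⟩

/-! ### Arbitrary profiles -/

section Profiles

variable {d : ℕ} {l : ℝ} {χ ψ : ℝ → ℝ}

lemma IsProfile.tendsto_apply_zero (h : IsProfile d l χ) : Tendsto χ (𝓝[>] 0) (𝓝 (χ 0)) :=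
  (h.continuousOn 0 self_mem_Ici).mono Ioi_subset_Ici_self

/-- A profile that vanishes at the origin and takes values in `[0, π / 2]` lies below every other
such profile with the same limit. -/
lemma IsProfile.le_of_mapsTo (hd : 3 ≤ d) (hχ : IsProfile d l χ) (hψ : IsProfile d l ψ)
    (hχ0 : χ 0 = 0) (hψ0 : ψ 0 = 0) (hχm : MapsTo χ (Ici 0) (Icc 0 (Real.pi / 2)))
    (hψm : MapsTo ψ (Ici 0) (Icc 0 (Real.pi / 2))) {ρ : ℝ} (hρ : 0 ≤ ρ) : χ ρ ≤ ψ ρ := by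
  have hd3 : (3 : ℝ) ≤ d := by exact_mod_cast hd
  rcases hρ.eq_or_lt with rfl | hρ
  · rw [hχ0, hψ0]
  have hcχ := hχ.tendsto_apply_zero
  have hcψ := hψ.tendsto_apply_zero
  rw [hχ0] at hcχ
  rw [hψ0] at hcψ
  have hvχ := (hχ.ode.flow.mono (Ioo_subset_Ioi_self (a := (1 : ℝ)))).tendsto_zero one_pos
    (by linarith) hcχ
  have hvψ := (hψ.ode.flow.mono (Ioo_subset_Ioi_self (a := (1 : ℝ)))).tendsto_zero one_pos
    (by linarith) hcψ
  rcases (hχm (mem_Ici.2 hρ.le)).1.eq_or_lt with h0 | h0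
  · rw [← h0]
    exact (hψm (mem_Ici.2 hρ.le)).1
  · have hpos : ∀ r, 0 < r → 0 < χ r := fun r hr => (hχm (mem_Ici.2 hr.le)).1.lt_of_ne
      (hχ.ode.flow.ne_zero (by linarith) hcχ hvχ hρ h0.ne' hr).symm
    exact hχ.ode.flow.le_of_same_limits hd3 hψ.ode.flow hcχ hcψ hvχ hvψ hχ.tendsto hψ.tendsto
      (fun r hr => (hχm (mem_Ici.2 hr.le)).2) (fun r hr => (hψm (mem_Ici.2 hr.le)).1)
      (fun r hr => hχ.ode.flow.deriv_pos (b := r) (by linarith) hcχ hvχ (fun t ht => hpos t ht.1)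
        (fun t ht => (hχm (mem_Ici.2 ht.1.le)).2) ⟨hr, le_rfl⟩) hρ

lemma IsProfile.eqOn_of_mapsTo (hd : 3 ≤ d) (hχ : IsProfile d l χ) (hψ : IsProfile d l ψ)
    (hχ0 : χ 0 = 0) (hψ0 : ψ 0 = 0) (hχm : MapsTo χ (Ici 0) (Icc 0 (Real.pi / 2)))
    (hψm : MapsTo ψ (Ici 0) (Icc 0 (Real.pi / 2))) : EqOn χ ψ (Ici 0) := fun _ hρ =>
  le_antisymm (hχ.le_of_mapsTo hd hψ hχ0 hψ0 hχm hψm hρ) (hψ.le_of_mapsTo hd hχ hψ0 hχ0 hψm hχm hρ)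

/-- In dimension at least `7` a positive regular solution has its limit in `(0, π / 2]`. -/
lemma ExpanderFlow.limit_mem {c m : ℝ} {v : ℝ → ℝ} (hc : 7 ≤ c) (h : ExpanderFlow c ψ v (Ioi 0))
    (hψ : Tendsto ψ (𝓝[>] 0) (𝓝 0)) (hv : Tendsto v (𝓝[>] 0) (𝓝 0))
    (hpos : ∀ ρ, 0 < ρ → 0 < ψ ρ) (hm : Tendsto ψ atTop (𝓝 m)) : m ∈ Ioc 0 (Real.pi / 2) := by
  have hlt : ∀ ρ, 0 < ρ → ψ ρ < Real.pi / 2 := fun ρ hρ => h.lt_pi_div_two hc hψ hv hpos hρ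
  have hmono : MonotoneOn ψ (Ioi 0) := monotoneOn_of_hasDerivAt_nonneg (convex_Ioi 0)
    (fun r hr => (h r hr).1) (fun r hr => div_nonneg (h.deriv_pos (b := r) (by linarith) hψ hv
      (fun t ht => hpos t ht.1) (fun t ht => (hlt t ht.1).le) ⟨hr, le_rfl⟩).le (le_of_lt hr))
  refine ⟨(hpos 1 one_pos).trans_le (ge_of_tendsto hm ?_), le_of_tendsto hm ?_⟩
  · filter_upwards [eventually_ge_atTop 1] with r hr
      using hmono (mem_Ioi.2 one_pos) (mem_Ioi.2 (one_pos.trans_le hr)) hr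
  · filter_upwards [eventually_gt_atTop 0] with r hr using (hlt r hr).le

/-- In dimension at least `7` every profile with limit in `[0, π / 2)` starts from the north pole and
takes values in `[0, π / 2]`: it starts at a multiple `k π` of `π`, stays within `π / 2` of it, and
its limit leaves no other choice than `k = 0`. -/
lemma IsProfile.apply_zero_and_mapsTo (hd : 7 ≤ d) (hχ : IsProfile d l χ)
    (hl : l ∈ Ico 0 (Real.pi / 2)) : χ 0 = 0 ∧ MapsTo χ (Ici 0) (Icc 0 (Real.pi / 2)) := by
  have hd7 : (7 : ℝ) ≤ d := by exact_mod_cast hd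
  have hpi := Real.pi_pos
  have hcχ := hχ.tendsto_apply_zero
  have hsin := (hχ.ode.flow.mono (Ioo_subset_Ioi_self (a := (1 : ℝ)))).sin_two_mul_eq_zero one_pos
    (by linarith) hcχ
  rw [Real.sin_two_mul] at hsin
  have hcos : Real.cos (χ 0) ≠ 0 := by
    intro h0
    have h1 : Tendsto (fun ρ => Real.cos (χ ρ)) atTop (𝓝 (Real.cos l)) :=
      (Real.continuous_cos.tendsto l).comp hχ.tendsto
    have h2 : Tendsto (fun ρ => Real.cos (χ ρ)) atTop (𝓝 0) := by
      refine tendsto_const_nhds.congr' ?_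
      filter_upwards [eventually_gt_atTop 0] with ρ hρ
        using (hχ.ode.flow.cos_eq_zero (by linarith) hcχ h0 hρ).symm
    have h3 := tendsto_nhds_unique h1 h2
    have h4 : 0 < Real.cos l := Real.cos_pos_of_mem_Ioo ⟨by linarith [hl.1], hl.2⟩
    linarith
  have hs0 : Real.sin (χ 0) = 0 := by
    rcases mul_eq_zero.1 hsin with h | h
    · linarith
    · exact absurd h hcos
  obtain ⟨k, hk⟩ := Real.sin_eq_zero_iff.1 hs0
  set f : ℝ → ℝ := fun ρ => χ ρ - k * Real.pi with hf
  have hfl := hχ.ode.flow.sub_int_mul_pi k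
  have hf0 : Tendsto f (𝓝[>] 0) (𝓝 0) := by
    have := hcχ.sub_const (χ 0)
    rw [sub_self, ← hk] at this
    exact this
  have hv := (hfl.mono (Ioo_subset_Ioi_self (a := (1 : ℝ)))).tendsto_zero one_pos
    (by linarith) hf0
  have hlim : Tendsto f atTop (𝓝 (l - k * Real.pi)) := hχ.tendsto.sub_const _
  have hk_le : ∀ j : ℤ, (k : ℝ) * Real.pi < (j + 1) * Real.pi → k ≤ j := fun j hj => by
    have h1 := lt_of_mul_lt_mul_right hj hpi.le
    have h2 : k < j + 1 := by exact_mod_cast h1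
    omega
  have hk_ge : ∀ j : ℤ, ((j : ℝ) - 1) * Real.pi < k * Real.pi → j ≤ k := fun j hj => by
    have h1 := lt_of_mul_lt_mul_right hj hpi.le
    have h2 : j - 1 < k := by exact_mod_cast h1
    omega
  have hconcl : k = 0 → (∀ ρ, 0 < ρ → f ρ ∈ Icc 0 (Real.pi / 2)) →
      χ 0 = 0 ∧ MapsTo χ (Ici 0) (Icc 0 (Real.pi / 2)) := by
    rintro rfl hmem
    have h0 : χ 0 = 0 := by rw [← hk]; simp
    refine ⟨h0, fun ρ hρ => ?_⟩
    rcases (mem_Ici.1 hρ).eq_or_lt with rfl | hρ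
    · rw [h0]
      exact ⟨le_rfl, by linarith⟩
    · simpa [hf] using hmem ρ hρ
  by_cases hz : ∀ ρ, 0 < ρ → f ρ = 0
  · have h1 : l - k * Real.pi = 0 := tendsto_nhds_unique hlim (tendsto_const_nhds.congr' (by
      filter_upwards [eventually_gt_atTop 0] with ρ hρ using (hz ρ hρ).symm))
    refine hconcl (le_antisymm (hk_le 0 ?_) (hk_ge 0 ?_)) (fun ρ hρ => by
      rw [hz ρ hρ]
      exact ⟨le_rfl, by linarith⟩)
    · push_cast
      linarith [hl.2]
    · push_cast
      linarith [hl.1]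
  push Not at hz
  obtain ⟨r, hr, hr0⟩ := hz
  have hne : ∀ ρ, 0 < ρ → f ρ ≠ 0 := fun ρ hρ => hfl.ne_zero (by linarith) hf0 hv hr hr0 hρ
  have hsign : (∀ ρ, 0 < ρ → 0 < f ρ) ∨ ∀ ρ, 0 < ρ → f ρ < 0 := by
    by_contra hno
    push Not at hno
    obtain ⟨⟨a, ha, ha0⟩, b, hb, hb0⟩ := hno
    have hcont : ContinuousOn f (Ioi 0) := fun ρ hρ =>
      (hfl ρ hρ).1.continuousAt.continuousWithinAt
    obtain ⟨x, hx, hx0⟩ := isPreconnected_Ioi.intermediate_value (mem_Ioi.2 ha) (mem_Ioi.2 hb)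
      hcont ⟨ha0, hb0⟩
    exact hne x hx hx0
  rcases hsign with hs | hs
  · have h1 := hfl.limit_mem hd7 hf0 hv hs hlim
    refine hconcl (le_antisymm (hk_le 0 ?_) (hk_ge 0 ?_)) (fun ρ hρ =>
      ⟨(hs ρ hρ).le, (hfl.lt_pi_div_two hd7 hf0 hv hs hρ).le⟩)
    · push_cast
      linarith [hl.2, h1.1]
    · push_cast
      linarith [hl.1, h1.2]
  · exfalso
    have hf0' := hf0.neg
    have hv' := hv.neg
    rw [neg_zero] at hf0' hv'
    have h1 := hfl.neg.limit_mem hd7 hf0' hv'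
      (fun ρ hρ => neg_pos.2 (hs ρ hρ)) hlim.neg
    have h2 : k ≤ 0 := hk_le 0 (by
      push_cast
      linarith [hl.2, h1.2])
    have h3 : 1 ≤ k := hk_ge 1 (by
      push_cast
      linarith [hl.1, h1.1])
    omega

/-! ### The reflection `ψ ↦ π - ψ` -/

lemma SolvesExpanderODE.pi_sub (h : SolvesExpanderODE d ψ) :
    SolvesExpanderODE d fun ρ => Real.pi - ψ ρ := by
  have h1 := h.flow.neg.sub_int_mul_pi (-1)
  have h2 : (fun ρ => -ψ ρ - ((-1 : ℤ) : ℝ) * Real.pi) = fun ρ => Real.pi - ψ ρ := by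
    ext ρ
    push_cast
    ring
  rw [h2] at h1
  exact h1.solves

lemma IsProfile.pi_sub (h : IsProfile d l ψ) :
    IsProfile d (Real.pi - l) fun ρ => Real.pi - ψ ρ :=
  ⟨continuousOn_const.sub h.continuousOn, h.ode.pi_sub, h.tendsto.const_sub _⟩

lemma isProfile_pi_sub_iff :
    IsProfile d l ψ ↔ IsProfile d (Real.pi - l) fun ρ => Real.pi - ψ ρ :=
  ⟨fun h => h.pi_sub, fun h => by simpa using h.pi_sub⟩

lemma northPole_iff_southPole_pi_sub :
    NorthPole ψ ↔ SouthPole fun ρ => Real.pi - ψ ρ := by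
  refine and_congr (by simp) ⟨fun ⟨α, hα⟩ => ⟨-α, hα.const_sub _⟩, fun ⟨α, hα⟩ => ⟨-α, ?_⟩⟩
  simpa using hα.const_sub Real.pi

end Profiles

/-! ### Existence and uniqueness of profiles -/

theorem theorem1p1 (d : ℕ) :
    -- (i) existence and uniqueness of the north pole profile with values in `[0, π/2]`
    (3 ≤ d → d ≤ 6 → ∀ ℓ ∈ Icc (0 : ℝ) (Real.pi / 2),
      ∃ ψ : ℝ → ℝ,
        (IsProfile d ℓ ψ ∧ NorthPole ψ ∧ MapsTo ψ (Ici 0) (Icc 0 (Real.pi / 2))) ∧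
        ∀ χ : ℝ → ℝ,
          IsProfile d ℓ χ ∧ NorthPole χ ∧ MapsTo χ (Ici 0) (Icc 0 (Real.pi / 2)) →
            EqOn χ ψ (Ici 0)) ∧
    -- (ii) existence of a south pole profile that crosses `π/2` exactly once
    (3 ≤ d → d ≤ 6 → ∃ δ ∈ Ioc (0 : ℝ) (Real.pi / 2),
      ∀ ℓ ∈ Ico (Real.pi / 2 - δ) (Real.pi / 2),
        ∃ ψ : ℝ → ℝ,
          IsProfile d ℓ ψ ∧ SouthPole ψ ∧ CrossesExactlyOnce ψ (Real.pi / 2)) ∧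
    -- (iii) exactly one profile, among all profiles, and it has north pole boundary conditions
    (7 ≤ d → ∀ ℓ ∈ Ico (0 : ℝ) (Real.pi / 2),
      ∃ ψ : ℝ → ℝ,
        IsProfile d ℓ ψ ∧ NorthPole ψ ∧
        ∀ χ : ℝ → ℝ, IsProfile d ℓ χ → EqOn χ ψ (Ici 0)) ∧
    -- the symmetry `ψ ↦ π - ψ`, which carries the case `ℓ ∈ [0, π/2]` to `ℓ ∈ [π/2, π]`
    (∀ (ℓ : ℝ) (ψ : ℝ → ℝ),
      (IsProfile d ℓ ψ ↔ IsProfile d (Real.pi - ℓ) (fun ρ => Real.pi - ψ ρ)) ∧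
      (NorthPole ψ ↔ SouthPole (fun ρ => Real.pi - ψ ρ))) := by
  refine ⟨fun hd hd6 ℓ hℓ => ?_, fun hd hd6 => ?_, fun hd ℓ hℓ => ?_,
    fun ℓ ψ => ⟨isProfile_pi_sub_iff, northPole_iff_southPole_pi_sub⟩⟩
  · obtain ⟨A, Ψ, V, hA, F, hcross⟩ := exists_regularFamily_crossing hd hd6
    obtain ⟨ψ, hψ, hn, hm⟩ := F.exists_profile hd hA.le hℓ.1 hℓ.2 (hℓ.2.trans hcross.le)
    exact ⟨ψ, ⟨hψ, hn, hm⟩, fun χ ⟨hχ, hχn, hχm⟩ =>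
      hχ.eqOn_of_mapsTo hd hψ hχn.1 hn.1 hχm hm⟩
  · obtain ⟨m, hm, hprof⟩ := exists_crossing_profiles hd hd6
    refine ⟨min (Real.pi / 2) (m - Real.pi / 2), ⟨lt_min (half_pos Real.pi_pos) (sub_pos.2 hm),
      min_le_left _ _⟩, fun ℓ hℓ => ?_⟩
    have hle := min_le_right (Real.pi / 2) (m - Real.pi / 2)
    obtain ⟨ψ, hψ, hn, x, hx, hx0, hbelow, habove⟩ := hprof (Real.pi - ℓ) (by linarith [hℓ.2])
      (by linarith [hℓ.1])
    refine ⟨fun ρ => Real.pi - ψ ρ, ?_, northPole_iff_southPole_pi_sub.1 hn, x, hx, ?_,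
      Or.inr ⟨fun ρ hρ => ?_, fun ρ hρ => ?_⟩⟩
    · simpa using hψ.pi_sub
    · linarith
    · linarith [hbelow ρ hρ]
    · linarith [habove ρ hρ]
  · have hd3 : 3 ≤ d := by omega
    have hd7 : (7 : ℝ) ≤ d := by exact_mod_cast hd
    obtain ⟨A, Ψ, V, hA, F, hnear⟩ := exists_regularFamily_near_equator hd3 (ρ₀ := 1)
      (η := Real.pi / 2 - ℓ) one_pos (sub_pos.2 hℓ.2) (by linarith [hℓ.1])
    have hmem : A ∈ Icc 0 A := right_mem_Icc.2 hA.le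
    have hlt := hnear fun ρ hρ => ((F.flow A hmem).lt_pi_div_two hd7 (F.tendsto_zero hmem)
      (F.tendsto_v A hmem) (fun r hr => F.pos A hmem hA r hr) hρ).le
    obtain ⟨ψ, hψ, hn, hm⟩ := F.exists_profile hd3 hA.le hℓ.1 hℓ.2.le
      (by linarith [F.le_halfLineSup hd3 hmem zero_le_one])
    exact ⟨ψ, hψ, hn, fun χ hχ =>
      hχ.eqOn_of_mapsTo hd3 hψ (hχ.apply_zero_and_mapsTo hd hℓ).1 hn.1
        (hχ.apply_zero_and_mapsTo hd hℓ).2 hm⟩
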